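/- **Setting.** Let $m\ge 1$, let $\mathcal W\subseteq\mathbb R^d$ be closed and convex, let $f,g_1,\dots,g_m:\mathcal W\to\mathbb R$ be convex, and put $g(w)=\max_i g_i(w)$. Let $D\ge 1$ satisfy $\|w-w'\|_2\le D$ for all $w,w'\in\mathcal W$. Suppose that $f$ is $L_f$-Lipschitz, that each $g_i$ is $L_g$-Lipschitz (Euclidean norm), and that for some $\rho>0$ we have $\|v\|_2\ge\rho$ whenever $g(w)=0$ and $v\in\partial g(w)$. Here $\partial\varphi(w)=\{v:\varphi(w')\ge\varphi(w)+\langle v,w'-w\rangle\ \forall w'\in\mathcal W\}$. Let $\gamma>L_f/\rho$ and $h(w)=f(w)+\gamma\max\{0,g(w)\}$. $\Pi_w$ and $\Pi_g$ denote the Euclidean projections onto $\mathcal W$ and onto $\{w\in\mathcal W:g(w)\le 0\}$. Let $\check\nabla\max\{0,g_i(w)\}\in\partial\max\{0,g_i\}(w)$ be a (measurable) choice of subgradients with $\|\check\nabla\max\{0,g_i(w)\}\|_2\le G_g$ for all $i$ and $w\in\mathcal W$. A stochastic subgradient of $f$ at iteration $t$ is a random vector $\check\Delta^{(t)}$ with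 $\|\check\Delta^{(t)}\|_2\le G_f$ almost surely whose conditional expectation given the past lies in $\partial f(w^{(t)})$. Assume $G_f,G_g\ge0$, $G_f+\gamma G_g>0$, and write $A=G_f+\gamma G_g+\gamma L_gD$. A *constraint check* is one evaluation or one differentiation of a single $g_i$. **FullTouch** ($T$, $\eta$). Start at an arbitrary $w^{(1)}\in\mathcal W$. For $t=1,\dots,T$: sample $\check\Delta^{(t)}$; evaluate all $g_j(w^{(t)})$, let $i$ be the index of a largest one, and set $w^{(t+1)}=\Pi_w\big(w^{(t)}-\eta(\check\Delta^{(t)}+\gamma\check\nabla\max\{0,g_i(w^{(t)})\})\big)$. **LightTouch** ($T$, $\eta$, $k\le m$). Start at an arbitrary $w^{(1)}\in\mathcal W$, with $p^{(1)}$ uniform on $\{1,\dots,m\}$ and $\mu^{(1)}_j=\max\{0,g_j(w^{(1)})\}$. For $t=1,\dots,T$: sample $\check\Delta^{(t)}$, an index $i^{(t)}$ which given the past has law $p^{(t)}$, and a set $S^{(t)}$ which given the past is uniform among the $k$-element subsets of $\{1,\dots,m\}$. Set $$w^{(t+1)}=\Pi_w\big(w^{(t)}-\eta(\check\Delta^{(t)}+\gamma\check\nabla\max\{0,g_{i^{(t)}}(w^{(t)})\})\big),$$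 $$\hat\Delta_p^{(t)}=\gamma\mu^{(t)}+\tfrac{\gamma m}{k}\sum_{j\in S^{(t)}}e_j\big(\max\{0,g_j(w^{(t)})\}-\mu_j^{(t)}\big),$$ $\tilde p^{(t+1)}=\exp(\ln p^{(t)}+\eta\hat\Delta_p^{(t)})$ elementwise, $p^{(t+1)}=\tilde p^{(t+1)}/\|\tilde p^{(t+1)}\|_1$, and $\mu^{(t+1)}_j=\max\{0,g_j(w^{(t)})\}$ for $j\in S^{(t)}$, $\mu^{(t+1)}_j=\mu^{(t)}_j$ otherwise. In both cases the output is $\bar w=\frac1T\sum_{t=1}^Tw^{(t)}$. **Theorem.** There are universal constants $c,K>0$ such that the following holds for all data as above and all $\epsilon>0$, $0<\delta<1$. Let $$T_\epsilon=\left\lceil c\,\frac{(1+\ln m)D^2A^2(1+\ln\frac1\delta)}{\epsilon^2}\right\rceil,\qquad k=\left\lceil\frac{m(1+\ln m)^{3/4}\sqrt{1+\ln\frac1\delta}\sqrt{1+\ln T_\epsilon}}{T_\epsilon^{1/4}}\right\rceil .$$ If $k\le m$, run $T_\epsilon$ iterations of LightTouch with minibatch size $k$ and $\eta=\frac{\sqrt{1+\ln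 m}\,D}{A\sqrt{T_\epsilon}}$. If $k>m$, run $T_\epsilon$ iterations of FullTouch with $\eta=\frac{D}{(G_f+\gamma G_g)\sqrt{T_\epsilon}}$. In either case, for every $w^*\in\mathcal W$ with $g_i(w^*)\le0$ for all $i$, with probability at least $1-\delta$: $$f(\Pi_g(\bar w))-f(w^*)\le h(\bar w)-h(w^*)\le\epsilon\quad\text{and}\quad\|\bar w-\Pi_g(\bar w)\|_2\le\frac{\epsilon}{\gamma\rho-L_f}.$$ Moreover, if $\epsilon\le DA$, the total number of constraint checks (including those of the initialization of $\mu$) is at most $$K\left(\frac{(1+\ln m)D^2A^2(1+\ln\frac1\delta)}{\epsilon^2}+\frac{m(1+\ln m)^{3/2}D^{3/2}A^{3/2}(1+\ln\frac1\delta)^{5/4}}{\epsilon^{3/2}}\sqrt{1+\ln T_\epsilon}\right).$$ -/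

import Mathlib

open MeasureTheory ProbabilityTheory
open scoped BigOperators NNReal ENNReal

noncomputable section

namespace LightTouch

/-- The ambient Euclidean space `ℝ^d`. -/
abbrev E (d : ℕ) : Type := EuclideanSpace ℝ (Fin d)

/-! ### The constrained problem -/

/-- The subdifferential at `w` of a function `φ : W → ℝ`: all `v` such that
`φ w' ≥ φ w + ⟨v, w' - w⟩` for every `w'` in the domain `W`. -/
def subdifferential {d : ℕ} (W : Set (E d)) (φ : E d → ℝ) (w : E d) : Set (E d) :=
  {v | ∀ w' ∈ W, φ w + inner ℝ v (w' - w) ≤ φ w'}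

/-- The combined constraint `g(w) = max_i g_i(w)`. -/
def maxConstraint {d m : ℕ} [NeZero m] (g : Fin m → E d → ℝ) (w : E d) : ℝ :=
  Finset.univ.sup' Finset.univ_nonempty (fun i => g i w)

/-- The feasible set `{w ∈ W : g_i(w) ≤ 0 for all i}`. -/
def feasible {d m : ℕ} (W : Set (E d)) (g : Fin m → E d → ℝ) : Set (E d) :=
  {w | w ∈ W ∧ ∀ i, g i w ≤ 0}

/-- The penalized objective `h(w) = f(w) + γ max(0, g(w))`. -/
def penalized {d m : ℕ} [NeZero m] (f : E d → ℝ) (g : Fin m → E d → ℝ) (γ : ℝ) (w : E d) : ℝ :=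
  f w + γ * max 0 (maxConstraint g w)

/-- Euclidean projection onto a set: a point of `K` nearest to `x`. (For nonempty closed convex
`K`, the only case that is used, it exists and is unique.) -/
def proj {d : ℕ} (K : Set (E d)) (x : E d) : E d :=
  Classical.epsilon fun y => y ∈ K ∧ ∀ z ∈ K, ‖x - y‖ ≤ ‖x - z‖

/-! ### Computations that count constraint checks -/

/-- The result of a computation together with the number of constraint checks (evaluations or
differentiations of a single `g_i`) that it has performed. -/
structure Counted (α : Type) where
  val : α
  checks : ℕ

instance : Monad Counted where
  pure a := ⟨a, 0⟩
  bind x k := ⟨(k x.val).val, x.checks + (k x.val).checks⟩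

/-- Evaluation of a single constraint: one check. -/
def checkValue {d m : ℕ} (g : Fin m → E d → ℝ) (i : Fin m) (w : E d) : Counted ℝ := ⟨g i w, 1⟩

/-- Differentiation of a single constraint, i.e. one call of the oracle `dg` that returns
a subgradient of `max(0, g_i)` at `w`: one check. -/
def checkGrad {d m : ℕ} (dg : Fin m → E d → E d) (i : Fin m) (w : E d) : Counted (E d) :=
  ⟨dg i w, 1⟩

/-- Perform the computation `F j` once for every `j ∈ S` and record the results in a vector, with
`0` at the places outside `S`. -/
def forEach {m : ℕ} (S : Finset (Fin m)) (F : Fin m → Counted ℝ) : Counted (Fin m → ℝ) :=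
  ⟨fun j => if j ∈ S then (F j).val else 0, ∑ j ∈ S, (F j).checks⟩

/-! ### FullTouch -/

/-- One iteration of FullTouch, given the sampled stochastic subgradient `ξ` of `f` at `w`.
`sel` is the rule that picks the index of a largest entry of a vector: the subgradient of
`max(0, g)` is that of `max(0, g_i)` for a most violated constraint `i`. -/
def fullStep {d m : ℕ} (W : Set (E d)) (g : Fin m → E d → ℝ) (dg : Fin m → E d → E d)
    (sel : (Fin m → ℝ) → Fin m) (γ η : ℝ) (w ξ : E d) : Counted (E d) := do
  let v ← forEach Finset.univ (fun j => checkValue g j w)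
  let u ← checkGrad dg (sel v) w
  pure (proj W (w - η • (ξ + γ • u)))

/-- The iterate of FullTouch after `t` iterations (so `0` is the initial point `w^{(1)}`). -/
def fullIter {d m : ℕ} (W : Set (E d)) (g : Fin m → E d → ℝ) (dg : Fin m → E d → E d)
    (sel : (Fin m → ℝ) → Fin m) (γ η : ℝ) (w₁ : E d) (ξ : ℕ → E d) : ℕ → Counted (E d)
  | 0 => pure w₁
  | t + 1 => do
    let w ← fullIter W g dg sel γ η w₁ ξ t
    fullStep W g dg sel γ η w (ξ t)

/-- `T` iterations of FullTouch, returning the average iterate `w̄ = (∑_{t=1}^T w^{(t)}) / T`. -/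
def fullTouch {d m : ℕ} (W : Set (E d)) (g : Fin m → E d → ℝ) (dg : Fin m → E d → E d)
    (sel : (Fin m → ℝ) → Fin m) (γ η : ℝ) (T : ℕ) (w₁ : E d) (ξ : ℕ → E d) : Counted (E d) where
  val := (T : ℝ)⁻¹ • ∑ t ∈ Finset.range T, (fullIter W g dg sel γ η w₁ ξ t).val
  checks := (fullIter W g dg sel γ η w₁ ξ T).checks

/-! ### LightTouch -/

/-- The variables that LightTouch maintains: the iterate `w`, the distribution `p` over the
constraints, and the remembered values `μ` of the `max(0, g_j)`. -/
structure State (d m : ℕ) where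
  w : E d
  p : Fin m → ℝ
  μ : Fin m → ℝ

/-- Initialization: `p` uniform, `μ_j = max(0, g_j(w₁))`. -/
def lightInit {d m : ℕ} (g : Fin m → E d → ℝ) (w₁ : E d) : Counted (State d m) := do
  let v ← forEach Finset.univ (fun j => checkValue g j w₁)
  pure { w := w₁, p := fun _ => 1 / (m : ℝ), μ := fun j => max 0 (v j) }

/-- The stochastic supergradient `γ μ + (γ m / k) ∑_{j ∈ S} e_j (max(0, g_j(w)) - μ_j)` with
respect to `p`, where `v j = g_j(w)` for `j ∈ S`. -/
def supergradient {m : ℕ} (γ : ℝ) (k : ℕ) (S : Finset (Fin m)) (v μ : Fin m → ℝ) : Fin m → ℝ :=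
  fun j => γ * μ j + γ * (m : ℝ) / (k : ℝ) * (if j ∈ S then max 0 (v j) - μ j else 0)

/-- The multiplicative update: `exp(ln p + η Δ)` elementwise, divided by its `ℓ¹` norm. -/
def multUpdate {m : ℕ} (η : ℝ) (p Δ : Fin m → ℝ) : Fin m → ℝ :=
  fun j => Real.exp (Real.log (p j) + η * Δ j) /
    ∑ l, |Real.exp (Real.log (p l) + η * Δ l)|

/-- One iteration of LightTouch, given the sampled stochastic subgradient `ξ` of `f`, constraint
index `i` and minibatch `S`. -/
def lightStep {d m : ℕ} (W : Set (E d)) (g : Fin m → E d → ℝ) (dg : Fin m → E d → E d)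
    (γ η : ℝ) (k : ℕ) (s : State d m) (ξ : E d) (i : Fin m) (S : Finset (Fin m)) :
    Counted (State d m) := do
  let u ← checkGrad dg i s.w
  let v ← forEach S (fun j => checkValue g j s.w)
  pure
    { w := proj W (s.w - η • (ξ + γ • u))
      p := multUpdate η s.p (supergradient γ k S v s.μ)
      μ := fun j => if j ∈ S then max 0 (v j) else s.μ j }

/-- The state of LightTouch after `t` iterations. -/
def lightIter {d m : ℕ} (W : Set (E d)) (g : Fin m → E d → ℝ) (dg : Fin m → E d → E d)
    (γ η : ℝ) (k : ℕ) (w₁ : E d) (ξ : ℕ → E d) (i : ℕ → Fin m) (S : ℕ → Finset (Fin m)) :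
    ℕ → Counted (State d m)
  | 0 => lightInit g w₁
  | t + 1 => do
    let s ← lightIter W g dg γ η k w₁ ξ i S t
    lightStep W g dg γ η k s (ξ t) (i t) (S t)

/-- `T` iterations of LightTouch, returning the average iterate `w̄ = (∑_{t=1}^T w^{(t)}) / T`. -/
def lightTouch {d m : ℕ} (W : Set (E d)) (g : Fin m → E d → ℝ) (dg : Fin m → E d → E d)
    (γ η : ℝ) (k T : ℕ) (w₁ : E d) (ξ : ℕ → E d) (i : ℕ → Fin m) (S : ℕ → Finset (Fin m)) :
    Counted (E d) where
  val := (T : ℝ)⁻¹ • ∑ t ∈ Finset.range T, (lightIter W g dg γ η k w₁ ξ i S t).val.w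
  checks := (lightIter W g dg γ η k w₁ ξ i S T).checks

/-! ### Randomness

Time is counted from `0`: `ℱ t` is the information available before iteration `t + 1`, in
which `ξ t`, `i t` and `S t` are sampled. -/

/-- `ξ 0, …, ξ (T - 1)` are stochastic subgradients of `f` along the iterates `w`: adapted, with
conditional mean in the subdifferential, and almost surely of norm at most `Gf`. -/
structure StochasticSubgradients {d : ℕ} {Ω : Type*} {mΩ : MeasurableSpace Ω} (P : Measure Ω)
    (ℱ : Filtration ℕ mΩ) (W : Set (E d)) (f : E d → ℝ) (Gf : ℝ) (T : ℕ)
    (w ξ : ℕ → Ω → E d) : Prop where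
  adapted : ∀ t < T, StronglyMeasurable[ℱ (t + 1)] (ξ t)
  unbiased : ∀ t < T, ∀ᵐ ω ∂P, (P[ξ t | ℱ t]) ω ∈ subdifferential W f (w t ω)
  bounded : ∀ t < T, ∀ᵐ ω ∂P, ‖ξ t ω‖ ≤ Gf

/-- `w₁` and `ξ` are the random inputs of a run of `T` iterations of FullTouch: an arbitrary
initial point of `W` and stochastic subgradients of `f` at the iterates. -/
structure FullExecution {d m : ℕ} {Ω : Type*} {mΩ : MeasurableSpace Ω} (P : Measure Ω)
    (ℱ : Filtration ℕ mΩ) (W : Set (E d)) (f : E d → ℝ) (g : Fin m → E d → ℝ)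
    (dg : Fin m → E d → E d) (sel : (Fin m → ℝ) → Fin m) (Gf γ η : ℝ) (T : ℕ)
    (w₁ : Ω → E d) (ξ : ℕ → Ω → E d) : Prop where
  init_measurable : StronglyMeasurable[ℱ 0] w₁
  init_mem : ∀ ω, w₁ ω ∈ W
  subgradients : StochasticSubgradients P ℱ W f Gf T
    (fun t ω => (fullIter W g dg sel γ η (w₁ ω) (fun s => ξ s ω) t).val) ξ

/-- `w₁`, `ξ`, `i`, `S` are the random inputs of a run of `T` iterations of LightTouch with
minibatches of size `k`: in each iteration, conditionally on the past, `ξ t` is a stochastic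
subgradient of `f` at the current iterate, the index `i t` is distributed according to the current
`p`, and `S t` is uniform among the `k`-element subsets of the constraints. -/
structure LightExecution {d m : ℕ} {Ω : Type*} {mΩ : MeasurableSpace Ω} (P : Measure Ω)
    (ℱ : Filtration ℕ mΩ) (W : Set (E d)) (f : E d → ℝ) (g : Fin m → E d → ℝ)
    (dg : Fin m → E d → E d) (Gf γ η : ℝ) (k T : ℕ)
    (w₁ : Ω → E d) (ξ : ℕ → Ω → E d) (i : ℕ → Ω → Fin m) (S : ℕ → Ω → Finset (Fin m)) :
    Prop where
  init_measurable : StronglyMeasurable[ℱ 0] w₁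
  init_mem : ∀ ω, w₁ ω ∈ W
  subgradients : StochasticSubgradients P ℱ W f Gf T
    (fun t ω => (lightIter W g dg γ η k (w₁ ω) (fun s => ξ s ω) (fun s => i s ω)
      (fun s => S s ω) t).val.w) ξ
  index_adapted : ∀ t < T, ∀ j, MeasurableSet[ℱ (t + 1)] {ω | i t ω = j}
  index_law : ∀ t < T, ∀ j,
    P[Set.indicator {ω | i t ω = j} (fun _ => (1 : ℝ)) | ℱ t] =ᵐ[P]
      fun ω => (lightIter W g dg γ η k (w₁ ω) (fun s => ξ s ω) (fun s => i s ω)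
        (fun s => S s ω) t).val.p j
  batch_card : ∀ t < T, ∀ ω, (S t ω).card = k
  batch_adapted : ∀ t < T, ∀ A, MeasurableSet[ℱ (t + 1)] {ω | S t ω = A}
  batch_law : ∀ t < T, ∀ A : Finset (Fin m), A.card = k →
    P[Set.indicator {ω | S t ω = A} (fun _ => (1 : ℝ)) | ℱ t] =ᵐ[P]
      fun _ => 1 / (m.choose k : ℝ)

/-! ### Parameters and guarantee -/

/-- The iteration count `T = ⌈c (1 + ln m) D² A² (1 + ln (1/δ)) / ε²⌉`. -/
def iterations (c : ℝ) (m : ℕ) (D A δ ε : ℝ) : ℕ :=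
  ⌈c * ((1 + Real.log m) * D ^ 2 * A ^ 2 * (1 + Real.log (1 / δ)) / ε ^ 2)⌉₊

/-- The minibatch size
`k = ⌈m (1 + ln m)^{3/4} √(1 + ln (1/δ)) √(1 + ln T) / T^{1/4}⌉`. -/
def minibatchSize (m : ℕ) (δ : ℝ) (T : ℕ) : ℕ :=
  ⌈(m : ℝ) * (1 + Real.log m) ^ (3 / 4 : ℝ) * Real.sqrt (1 + Real.log (1 / δ)) *
    Real.sqrt (1 + Real.log T) / (T : ℝ) ^ (1 / 4 : ℝ)⌉₊

/-- The bound on the number of constraint checks, up to the constant factor. -/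
def checksBound (m : ℕ) (D A δ ε : ℝ) (T : ℕ) : ℝ :=
  (1 + Real.log m) * D ^ 2 * A ^ 2 * (1 + Real.log (1 / δ)) / ε ^ 2 +
    (m : ℝ) * (1 + Real.log m) ^ (3 / 2 : ℝ) * D ^ (3 / 2 : ℝ) * A ^ (3 / 2 : ℝ) *
      (1 + Real.log (1 / δ)) ^ (5 / 4 : ℝ) / ε ^ (3 / 2 : ℝ) * Real.sqrt (1 + Real.log T)

/-- The guarantee on the average iterate `wbar` relative to the reference point `wstar`:
`f(Π_g(w̄)) - f(w*) ≤ h(w̄) - h(w*) ≤ ε` and `‖w̄ - Π_g(w̄)‖ ≤ ε / (γ ρ - L_f)`. -/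
def Guarantee {d m : ℕ} [NeZero m] (W : Set (E d)) (f : E d → ℝ) (g : Fin m → E d → ℝ)
    (γ ρ Lf ε : ℝ) (wstar wbar : E d) : Prop :=
  f (proj (feasible W g) wbar) - f wstar ≤ penalized f g γ wbar - penalized f g γ wstar ∧
  penalized f g γ wbar - penalized f g γ wstar ≤ ε ∧
  ‖wbar - proj (feasible W g) wbar‖ ≤ ε / (γ * ρ - Lf)

end LightTouch

end

open LightTouch

/-!
The norm of a subgradient of `max_i g_i` at a zero is at least `ρ`, so the constraint violation at
`w` is at least `ρ` times the distance from `w` to the feasible set. Since `γ ρ > L_f`, exact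
penalization is strict: projecting onto the feasible set does not increase `h`, and the decrease
is at least `γ ρ - L_f` times the distance moved. It therefore suffices that the average iterate
has a small gap in `h` relative to a feasible minimizer `u` of `f`.

Both algorithms play the zero-sum game `f w + γ ∑ⱼ pⱼ max (0, gⱼ w)`. The minimizing player uses
projected stochastic subgradient descent. In FullTouch the other player answers with a maximal
constraint; in LightTouch it uses multiplicative weights on the estimates `Δ̂`. The noise of these
estimates is proportional to the error of the remembered values `μ`, which is small if every entry
of `μ` has been refreshed recently, as is the case with high probability. Conditioning on this event
would destroy the martingale property. The noise is therefore clipped, which turns it into bounded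
martingale differences, to which the Azuma-Hoeffding inequality applies, and which agree with the
noise on the event.
-/

namespace LightTouch

section Projection

variable {d : ℕ} {K : Set (E d)}

lemma proj_spec (hK : IsClosed K) (hne : K.Nonempty) (x : E d) :
    proj K x ∈ K ∧ ∀ z ∈ K, ‖x - proj K x‖ ≤ ‖x - z‖ := by
  refine Classical.epsilon_spec (p := fun y => y ∈ K ∧ ∀ z ∈ K, ‖x - y‖ ≤ ‖x - z‖) ?_
  obtain ⟨y, hy, hxy⟩ := hK.exists_infDist_eq_dist hne x
  refine ⟨y, hy, fun z hz => ?_⟩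
  rw [← dist_eq_norm, ← dist_eq_norm, ← hxy]
  exact Metric.infDist_le_dist_of_mem hz

lemma proj_mem (hK : IsClosed K) (hne : K.Nonempty) (x : E d) : proj K x ∈ K :=
  (proj_spec hK hne x).1

lemma proj_of_mem (hK : IsClosed K) {x : E d} (hx : x ∈ K) : proj K x = x := by
  have h := (proj_spec hK ⟨x, hx⟩ x).2 x hx
  rw [sub_self, norm_zero] at h
  exact (sub_eq_zero.1 (norm_le_zero_iff.1 h)).symm

lemma inner_sub_proj_nonpos (hcv : Convex ℝ K) (hK : IsClosed K) (x : E d) {z : E d} (hz : z ∈ K) :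
    inner ℝ (x - proj K x) (z - proj K x) ≤ 0 := by
  obtain ⟨hmem, hmin⟩ := proj_spec hK ⟨z, hz⟩ x
  refine (norm_eq_iInf_iff_real_inner_le_zero hcv hmem).1 ?_ z hz
  have : Nonempty K := ⟨⟨z, hz⟩⟩
  refine le_antisymm (le_ciInf fun y => hmin y y.2) ?_
  exact ciInf_le ⟨0, by rintro _ ⟨y, rfl⟩; exact norm_nonneg _⟩ (⟨proj K x, hmem⟩ : K)

lemma norm_proj_sub_proj_le (hcv : Convex ℝ K) (hK : IsClosed K) (hne : K.Nonempty) (x y : E d) :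
    ‖proj K x - proj K y‖ ≤ ‖x - y‖ := by
  have hx := inner_sub_proj_nonpos hcv hK x (proj_mem hK hne y)
  have hy := inner_sub_proj_nonpos hcv hK y (proj_mem hK hne x)
  set a := proj K x
  set b := proj K y
  have hsq : ‖a - b‖ ^ 2 ≤ inner ℝ (x - y) (a - b) := by
    rw [← real_inner_self_eq_norm_sq]
    have e : inner ℝ (x - y) (a - b) - inner ℝ (a - b) (a - b)
        = - inner ℝ (x - a) (b - a) - inner ℝ (y - b) (a - b) := by
      rw [← inner_neg_right, neg_sub, ← inner_sub_left, ← inner_sub_left]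
      congr 1; abel
    linarith
  by_contra! h
  nlinarith [real_inner_le_norm (x - y) (a - b), norm_nonneg (x - y)]

lemma continuous_proj (hcv : Convex ℝ K) (hK : IsClosed K) (hne : K.Nonempty) :
    Continuous (proj K) :=
  (LipschitzWith.of_dist_le_mul (K := 1) fun x y => by
    simpa [dist_eq_norm] using norm_proj_sub_proj_le hcv hK hne x y).continuous

lemma norm_proj_sub_le (hcv : Convex ℝ K) (hK : IsClosed K) (x : E d) {z : E d} (hz : z ∈ K) :
    ‖proj K x - z‖ ≤ ‖x - z‖ := by
  simpa only [proj_of_mem hK hz] using norm_proj_sub_proj_le hcv hK ⟨z, hz⟩ x z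

end Projection

section Multiplier

variable {V : Type*} [AddCommGroup V] [Module ℝ V] {W : Set V} {φ : V → ℝ} {ℓ : V →ₗ[ℝ] ℝ} {c : ℝ}

lemma nonneg_of_pos_on_halfSpace (hφ : ConvexOn ℝ W φ) (hpos : ∀ x ∈ W, c < ℓ x → 0 < φ x)
    {w x : V} (hw : w ∈ W) (hcw : c < ℓ w) (hx : x ∈ W) (hcx : ℓ x = c) : 0 ≤ φ x := by
  by_contra! hneg
  have hden : 0 < φ w - φ x := by linarith [hpos w hw hcw]
  -- the chord from `x` to `w` vanishes at this parameter, where `φ` should be positive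
  set θ := -φ x / (φ w - φ x) with hθ
  have hθ0 : 0 < θ := div_pos (neg_pos.2 hneg) hden
  have hθ1 : θ ≤ 1 := by rw [hθ, div_le_one hden]; linarith [hpos w hw hcw]
  have hmem := hφ.1 hx hw (sub_nonneg.2 hθ1) hθ0.le (sub_add_cancel 1 θ)
  have hchord := hφ.2 hx hw (sub_nonneg.2 hθ1) hθ0.le (sub_add_cancel 1 θ)
  have hzero : (1 - θ) • φ x + θ • φ w = 0 := by
    rw [smul_eq_mul, smul_eq_mul, hθ]; field_simp; ring
  refine (hpos _ hmem ?_).not_ge (hchord.trans hzero.le)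
  simp only [map_add, map_smul, smul_eq_mul, hcx]
  nlinarith

lemma cross_ratio_nonneg (hφ : ConvexOn ℝ W φ) (hnonneg : ∀ x ∈ W, ℓ x = c → 0 ≤ φ x)
    {x y : V} (hx : x ∈ W) (hy : y ∈ W) (hcx : ℓ x < c) (hcy : c < ℓ y) :
    0 ≤ (ℓ y - c) * φ x + (c - ℓ x) * φ y := by
  have hden : 0 < ℓ y - ℓ x := by linarith
  have ha : 0 ≤ (ℓ y - c) / (ℓ y - ℓ x) := div_nonneg (by linarith) hden.le
  have hb : 0 ≤ (c - ℓ x) / (ℓ y - ℓ x) := div_nonneg (by linarith) hden.le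
  have hab : (ℓ y - c) / (ℓ y - ℓ x) + (c - ℓ x) / (ℓ y - ℓ x) = 1 := by field_simp; ring
  have hlevel : ℓ (((ℓ y - c) / (ℓ y - ℓ x)) • x + ((c - ℓ x) / (ℓ y - ℓ x)) • y) = c := by
    simp only [map_add, map_smul, smul_eq_mul]
    field_simp; ring
  have h := (hnonneg _ (hφ.1 hx hy ha hb hab) hlevel).trans (hφ.2 hx hy ha hb hab)
  rw [smul_eq_mul, smul_eq_mul, div_mul_eq_mul_div, div_mul_eq_mul_div, ← add_div] at h
  by_contra! hneg
  exact (div_neg_of_neg_of_pos hneg hden).not_ge h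

/-- A Lagrange multiplier for the half-space `{c < ℓ}`: the infimum of the slopes
`φ x / (ℓ x - c)` over the part of `W` in this half-space. -/
lemma exists_multiplier (hφ : ConvexOn ℝ W φ) (hpos : ∀ x ∈ W, c < ℓ x → 0 < φ x)
    {w : V} (hw : w ∈ W) (hcw : c < ℓ w) : ∃ s ≥ 0, ∀ x ∈ W, s * (ℓ x - c) ≤ φ x := by
  have hnonneg : ∀ x ∈ W, ℓ x = c → 0 ≤ φ x := fun x hx hcx =>
    nonneg_of_pos_on_halfSpace hφ hpos hw hcw hx hcx
  set Q : Set ℝ := (fun x => φ x / (ℓ x - c)) '' {x | x ∈ W ∧ c < ℓ x}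
  have hQ : Q.Nonempty := ⟨_, w, ⟨hw, hcw⟩, rfl⟩
  have hQ0 : ∀ q ∈ Q, 0 ≤ q := by
    rintro _ ⟨x, ⟨hx, hcx⟩, rfl⟩
    exact div_nonneg (hpos x hx hcx).le (sub_nonneg.2 hcx.le)
  refine ⟨sInf Q, le_csInf hQ hQ0, fun x hx => ?_⟩
  rcases lt_trichotomy (ℓ x) c with hcx | hcx | hcx
  · have hslope : -φ x / (c - ℓ x) ≤ sInf Q := by
      refine le_csInf hQ ?_
      rintro _ ⟨y, ⟨hy, hcy⟩, rfl⟩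
      rw [div_le_div_iff₀ (sub_pos.2 hcx) (sub_pos.2 hcy)]
      linarith [cross_ratio_nonneg hφ hnonneg hx hy hcx hcy]
    rw [div_le_iff₀ (sub_pos.2 hcx)] at hslope
    linarith
  · simpa only [hcx, sub_self, mul_zero] using hnonneg x hx hcx
  · exact (le_div_iff₀ (sub_pos.2 hcx)).1 (csInf_le ⟨0, hQ0⟩ ⟨x, ⟨hx, hcx⟩, rfl⟩)

end Multiplier

section ErrorBound

variable {d : ℕ} {W : Set (E d)} {φ : E d → ℝ} {ρ : ℝ}

lemma exists_smul_mem_subdifferential_proj (hφ : ConvexOn ℝ W φ)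
    (hK : IsClosed {x | x ∈ W ∧ φ x ≤ 0}) (hne : {x | x ∈ W ∧ φ x ≤ 0}.Nonempty) {w : E d}
    (hw : w ∈ W) (hpos : 0 < φ w) :
    φ (proj {x | x ∈ W ∧ φ x ≤ 0} w) = 0 ∧ ∃ s ≥ 0,
      s * ‖w - proj {x | x ∈ W ∧ φ x ≤ 0} w‖ ^ 2 ≤ φ w ∧
      s • (w - proj {x | x ∈ W ∧ φ x ≤ 0} w) ∈
        subdifferential W φ (proj {x | x ∈ W ∧ φ x ≤ 0} w) := by
  obtain ⟨hvW, hv0⟩ := proj_mem hK hne w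
  have hsep : ∀ x ∈ W, φ x ≤ 0 → inner ℝ (w - proj _ w) (x - proj _ w) ≤ 0 := fun x hx hx0 =>
    inner_sub_proj_nonpos (hφ.convex_le 0) hK w ⟨hx, hx0⟩
  set v := proj {x | x ∈ W ∧ φ x ≤ 0} w
  have hwv : 0 < ‖w - v‖ := norm_sub_pos_iff.2 fun h => hpos.not_ge (h ▸ hv0)
  have hinner : ∀ x, innerₛₗ ℝ (w - v) x - innerₛₗ ℝ (w - v) v = inner ℝ (w - v) (x - v) :=
    fun x => by rw [innerₛₗ_apply_apply, innerₛₗ_apply_apply, inner_sub_right]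
  have hhalf : ∀ x ∈ W, innerₛₗ ℝ (w - v) v < innerₛₗ ℝ (w - v) x → 0 < φ x := by
    intro x hx hlt
    by_contra! hx0
    linarith [hsep x hx hx0, hinner x]
  have hcw : innerₛₗ ℝ (w - v) v < innerₛₗ ℝ (w - v) w := by
    rw [← sub_pos, hinner, real_inner_self_eq_norm_sq]; positivity
  have hφv : φ v = 0 := le_antisymm hv0 (nonneg_of_pos_on_halfSpace hφ hhalf hw hcw hvW rfl)
  obtain ⟨s, hs, hsle⟩ := exists_multiplier hφ hhalf hw hcw
  simp only [hinner] at hsle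
  refine ⟨hφv, s, hs, real_inner_self_eq_norm_sq (w - v) ▸ hsle w hw, fun x hx => ?_⟩
  rw [hφv, zero_add, real_inner_smul_left]
  exact hsle x hx

lemma mul_norm_sub_proj_le (hφ : ConvexOn ℝ W φ) (hK : IsClosed {x | x ∈ W ∧ φ x ≤ 0})
    (hne : {x | x ∈ W ∧ φ x ≤ 0}.Nonempty)
    (hρ : ∀ w ∈ W, φ w = 0 → ∀ v ∈ subdifferential W φ w, ρ ≤ ‖v‖) {w : E d} (hw : w ∈ W) :
    ρ * ‖w - proj {x | x ∈ W ∧ φ x ≤ 0} w‖ ≤ max 0 (φ w) := by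
  rcases le_or_gt (φ w) 0 with hw0 | hw0
  · simp [proj_of_mem hK (show w ∈ {x | x ∈ W ∧ φ x ≤ 0} from ⟨hw, hw0⟩)]
  obtain ⟨hv0, s, hs, hsw, hsub⟩ := exists_smul_mem_subdifferential_proj hφ hK hne hw hw0
  have hρs := hρ _ (proj_mem hK hne w).1 hv0 _ hsub
  set v := proj {x | x ∈ W ∧ φ x ≤ 0} w
  rw [norm_smul, Real.norm_of_nonneg hs] at hρs
  calc ρ * ‖w - v‖ ≤ s * ‖w - v‖ * ‖w - v‖ := by gcongr
    _ = s * ‖w - v‖ ^ 2 := by ring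
    _ ≤ φ w := hsw
    _ ≤ max 0 (φ w) := le_max_right _ _

end ErrorBound

section Average

variable {V : Type*} [AddCommGroup V] [Module ℝ V] {W : Set V} {T : ℕ} {w : ℕ → V}

lemma average_mem (hW : Convex ℝ W) (hT : 0 < T) (hw : ∀ t, w t ∈ W) :
    (T : ℝ)⁻¹ • ∑ t ∈ Finset.range T, w t ∈ W := by
  rw [Finset.smul_sum]
  exact hW.sum_mem (fun _ _ => by positivity) (by simp [hT.ne']) fun t _ => hw t

lemma average_le {φ : V → ℝ} (hφ : ConvexOn ℝ W φ) (hT : 0 < T) (hw : ∀ t, w t ∈ W) :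
    φ ((T : ℝ)⁻¹ • ∑ t ∈ Finset.range T, w t) ≤ (∑ t ∈ Finset.range T, φ (w t)) / T := by
  have h := hφ.map_sum_le (t := Finset.range T) (w := fun _ => (T : ℝ)⁻¹) (p := w)
    (fun _ _ => by positivity) (by simp [hT.ne']) fun t _ => hw t
  rwa [← Finset.smul_sum, ← Finset.smul_sum, smul_eq_mul, ← div_eq_inv_mul] at h

end Average

section ConstrainedProblem

variable {d m : ℕ} [NeZero m] {W : Set (E d)} {f : E d → ℝ} {g : Fin m → E d → ℝ}

lemma maxConstraint_le_iff {w : E d} {a : ℝ} : maxConstraint g w ≤ a ↔ ∀ i, g i w ≤ a := by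
  simp [maxConstraint]

lemma le_maxConstraint (i : Fin m) (w : E d) : g i w ≤ maxConstraint g w :=
  maxConstraint_le_iff.1 le_rfl i

lemma exists_eq_maxConstraint (w : E d) : ∃ i, maxConstraint g w = g i w := by
  obtain ⟨i, -, hi⟩ := Finset.exists_mem_eq_sup' (Finset.univ_nonempty (α := Fin m)) fun i => g i w
  exact ⟨i, hi⟩

lemma feasible_eq_sublevel : feasible W g = {w | w ∈ W ∧ maxConstraint g w ≤ 0} := by
  simp only [feasible, maxConstraint_le_iff]

lemma convexOn_maxConstraint (hg : ∀ i, ConvexOn ℝ W (g i)) : ConvexOn ℝ W (maxConstraint g) := by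
  refine ⟨(hg 0).1, fun x hx y hy a b ha hb hab => maxConstraint_le_iff.2 fun i => ?_⟩
  refine ((hg i).2 hx hy ha hb hab).trans ?_
  simp only [smul_eq_mul]
  gcongr <;> exact le_maxConstraint _ _

omit [NeZero m] in
lemma isClosed_feasible (hW : IsClosed W) (hg : ∀ i, ContinuousOn (g i) W) :
    IsClosed (feasible W g) := by
  have e : feasible W g = W ∩ ⋂ i, W ∩ g i ⁻¹' Set.Iic 0 := by
    ext w
    simp only [feasible, Set.mem_ofPred_eq, Set.mem_inter_iff, Set.mem_iInter, Set.mem_preimage,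
      Set.mem_Iic]
    exact ⟨fun h => ⟨h.1, fun i => ⟨h.1, h.2 i⟩⟩, fun h => ⟨h.1, fun i => (h.2 i).2⟩⟩
  rw [e]
  exact hW.inter (isClosed_iInter fun i => (hg i).preimage_isClosed_of_isClosed hW isClosed_Iic)

omit [NeZero m] in
lemma exists_feasible_minimizer (hW : IsClosed W) (hWb : Bornology.IsBounded W)
    (hf : ContinuousOn f W) (hg : ∀ i, ContinuousOn (g i) W) (hne : (feasible W g).Nonempty) :
    ∃ u ∈ feasible W g, ∀ x ∈ feasible W g, f u ≤ f x := by
  have hsub : feasible W g ⊆ W := fun _ h => h.1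
  have hcompact := Metric.isCompact_of_isClosed_isBounded (isClosed_feasible hW hg)
    (hWb.subset hsub)
  exact hcompact.exists_isMinOn hne (hf.mono hsub)

lemma penalized_of_feasible {γ : ℝ} {w : E d} (hw : w ∈ feasible W g) :
    penalized f g γ w = f w := by
  rw [feasible_eq_sublevel] at hw
  rw [penalized, max_eq_left hw.2, mul_zero, add_zero]

/-- Moving `w` to its projection costs at most `Lf` times the distance in `f`, but saves at least
`γ ρ` times the distance in the penalty, by the error bound. -/
lemma guarantee_of_penalized_sub_le (hW : IsClosed W) (hg : ∀ i, ConvexOn ℝ W (g i)) {Lf : ℝ≥0}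
    (hf : LipschitzOnWith Lf f W) (hgc : ∀ i, ContinuousOn (g i) W) {ρ : ℝ}
    (hρ : ∀ w ∈ W, maxConstraint g w = 0 →
      ∀ v ∈ subdifferential W (maxConstraint g) w, ρ ≤ ‖v‖)
    {γ : ℝ} (hγ : 0 ≤ γ) (hγρ : Lf < γ * ρ) {ε : ℝ} {u w wstar : E d} (hw : w ∈ W)
    (hstar : wstar ∈ feasible W g) (hu : ∀ x ∈ feasible W g, f u ≤ f x)
    (h : penalized f g γ w - f u ≤ ε) :
    Guarantee W f g γ ρ Lf ε wstar w := by
  have hF := isClosed_feasible hW hgc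
  have hvF := proj_mem hF ⟨_, hstar⟩ w
  have hbound : ρ * ‖w - proj (feasible W g) w‖ ≤ max 0 (maxConstraint g w) := by
    rw [feasible_eq_sublevel] at hF hstar ⊢
    exact mul_norm_sub_proj_le (convexOn_maxConstraint hg) hF ⟨_, hstar⟩ hρ hw
  have hLip : |f w - f (proj (feasible W g) w)| ≤ Lf * ‖w - proj (feasible W g) w‖ := by
    simpa [dist_eq_norm, Real.dist_eq] using hf.dist_le_mul w hw _ hvF.1
  have hustar := hu _ hstar
  have huv := hu _ hvF
  rw [Guarantee, penalized_of_feasible hstar]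
  set v := proj (feasible W g) w
  have hpenalty : γ * ρ * ‖w - v‖ ≤ γ * max 0 (maxConstraint g w) := by
    rw [mul_assoc]; gcongr
  have hslack : Lf * ‖w - v‖ ≤ γ * ρ * ‖w - v‖ := by gcongr
  have hfv := abs_le.1 hLip
  rw [penalized] at h ⊢
  refine ⟨by linarith, by linarith, ?_⟩
  rw [le_div_iff₀ (by linarith)]
  linarith

lemma penalized_average_sub_le {γ : ℝ} (hγ : 0 ≤ γ) (hf : ConvexOn ℝ W f)
    (hg : ∀ i, ConvexOn ℝ W (g i)) {T : ℕ} (hT : 0 < T) {w : ℕ → E d} (hw : ∀ t, w t ∈ W) {a ε : ℝ}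
    (h : ∀ j, ∑ t ∈ Finset.range T, (f (w t) + γ * max 0 (g j (w t)) - a) ≤ ε * T) :
    penalized f g γ ((T : ℝ)⁻¹ • ∑ t ∈ Finset.range T, w t) - a ≤ ε := by
  obtain ⟨j, hj⟩ := exists_eq_maxConstraint (g := g) ((T : ℝ)⁻¹ • ∑ t ∈ Finset.range T, w t)
  have hconvex : ConvexOn ℝ W fun x => f x + γ * max 0 (g j x) :=
    hf.add (((convexOn_const 0 hf.1).sup (hg j)).smul hγ)
  have hsum := h j
  rw [Finset.sum_sub_distrib, Finset.sum_const, Finset.card_range, nsmul_eq_mul] at hsum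
  rw [penalized, hj, sub_le_iff_le_add]
  refine (average_le hconvex hT hw).trans ?_
  rw [div_le_iff₀ (Nat.cast_pos.2 hT)]
  linarith

lemma exists_feasible_forall_guarantee (hW : IsClosed W) (hWb : Bornology.IsBounded W)
    (hf : ConvexOn ℝ W f) (hg : ∀ i, ConvexOn ℝ W (g i)) {Lf : ℝ≥0} (hfL : LipschitzOnWith Lf f W)
    (hgc : ∀ i, ContinuousOn (g i) W) {ρ : ℝ}
    (hρ : ∀ w ∈ W, maxConstraint g w = 0 →
      ∀ v ∈ subdifferential W (maxConstraint g) w, ρ ≤ ‖v‖)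
    {γ : ℝ} (hγ : 0 ≤ γ) (hγρ : Lf < γ * ρ) (ε : ℝ) {wstar : E d} (hstar : wstar ∈ feasible W g)
    {T : ℕ} (hT : 0 < T) :
    ∃ u ∈ feasible W g, ∀ w : ℕ → E d, (∀ t, w t ∈ W) →
      (∀ j, ∑ t ∈ Finset.range T, (f (w t) + γ * max 0 (g j (w t)) - f u) ≤ ε * T) →
      Guarantee W f g γ ρ Lf ε wstar ((T : ℝ)⁻¹ • ∑ t ∈ Finset.range T, w t) := by
  obtain ⟨u, hu, hmin⟩ := exists_feasible_minimizer hW hWb hfL.continuousOn hgc ⟨_, hstar⟩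
  exact ⟨u, hu, fun w hw h => guarantee_of_penalized_sub_le hW hg hfL hgc hρ hγ hγρ
    (average_mem hf.1 hT hw) hstar hmin (penalized_average_sub_le hγ hf hg hT hw h)⟩

end ConstrainedProblem

/-! ### Concentration of bounded martingale differences -/

lemma exp_mul_le_chord {y b : ℝ} (hb : 0 < b) (hy : |y| ≤ b) (l : ℝ) :
    Real.exp (l * y) ≤ Real.cosh (l * b) + Real.sinh (l * b) / b * y := by
  have h := Real.exp_mul_le_cosh_add_mul_sinh (t := y / b)
    (by rwa [abs_div, abs_of_pos hb, div_le_one hb]) (l * b)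
  rw [show y / b * (l * b) = l * y by field_simp] at h
  exact h.trans_eq (by ring)

section Conditioning

variable {Ω : Type*} {m₀ mΩ : MeasurableSpace Ω} {P : Measure Ω} [IsFiniteMeasure P]

lemma integrable_of_ae_bound {F : Type*} [NormedAddCommGroup F] {Y : Ω → F}
    (hY : AEStronglyMeasurable Y P) {C : ℝ} (hC : ∀ᵐ ω ∂P, ‖Y ω‖ ≤ C) : Integrable Y P :=
  (integrable_const C).mono' hY hC

lemma condExp_comp_index {ι : Type*} [Fintype ι] (hm : m₀ ≤ mΩ) {I : Ω → ι}
    (hI : ∀ i, MeasurableSet {ω | I ω = i}) {p : ι → Ω → ℝ}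
    (hp : ∀ i, P[Set.indicator {ω | I ω = i} (fun _ => (1 : ℝ)) | m₀] =ᵐ[P] p i)
    {Z : ι → Ω → ℝ} (hZ : ∀ i, StronglyMeasurable[m₀] (Z i)) {C : ℝ}
    (hC : ∀ i, ∀ᵐ ω ∂P, ‖Z i ω‖ ≤ C) :
    P[fun ω => Z (I ω) ω | m₀] =ᵐ[P] fun ω => ∑ i, p i ω * Z i ω := by
  classical
  have hind : ∀ i, Integrable (Set.indicator {ω | I ω = i} fun _ => (1 : ℝ)) P := fun i =>
    (integrable_const 1).indicator (hI i)
  have hsplit : (fun ω => Z (I ω) ω) =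
      ∑ i, Z i * Set.indicator {ω | I ω = i} (fun _ => (1 : ℝ)) := by
    ext ω
    simp [Finset.sum_apply, Set.indicator_apply]
  have hintegrable : ∀ i, Integrable (Z i * Set.indicator {ω | I ω = i} (fun _ => (1 : ℝ))) P :=
    fun i => (hind i).bdd_mul ((hZ i).mono hm).aestronglyMeasurable (hC i)
  have hpull : ∀ i, P[Z i * Set.indicator {ω | I ω = i} (fun _ => (1 : ℝ)) | m₀] =ᵐ[P]
      fun ω => p i ω * Z i ω := fun i => by
    refine (condExp_stronglyMeasurable_mul_of_bound hm (hZ i) (hind i) C (hC i)).trans ?_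
    filter_upwards [hp i] with ω hω
    rw [Pi.mul_apply, hω, mul_comm]
  rw [hsplit]
  refine (condExp_finsetSum (fun i _ => hintegrable i) m₀).trans ?_
  filter_upwards [ae_all_iff.2 hpull] with ω hω
  simp only [Finset.sum_apply, hω]

lemma condExp_exp_mul_le (hm : m₀ ≤ mΩ) {X : Ω → ℝ} (hX : AEStronglyMeasurable X P) {b : ℝ}
    (hb : 0 < b) (hXb : ∀ᵐ ω ∂P, |X ω| ≤ b) (hX0 : P[X | m₀] =ᵐ[P] 0) (l : ℝ) :
    P[fun ω => Real.exp (l * X ω) | m₀] ≤ᵐ[P] fun _ => Real.exp ((l * b) ^ 2 / 2) := by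
  have hXi : Integrable X P := integrable_of_ae_bound hX hXb
  have hexp : Integrable (fun ω => Real.exp (l * X ω)) P :=
    integrable_exp_mul_of_mem_Icc hX.aemeasurable (hXb.mono fun ω hω => abs_le.1 hω)
  have hchord : (fun ω => Real.exp (l * X ω)) ≤ᵐ[P]
      (fun _ => Real.cosh (l * b)) + (Real.sinh (l * b) / b) • X := by
    filter_upwards [hXb] with ω hω
    exact exp_mul_le_chord hb hω l
  filter_upwards [condExp_mono (m := m₀) hexp ((integrable_const _).add (hXi.smul _)) hchord,
    condExp_add (integrable_const (Real.cosh (l * b))) (hXi.smul (Real.sinh (l * b) / b)) m₀,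
    condExp_smul (μ := P) (Real.sinh (l * b) / b) X m₀, hX0] with ω hle hadd hsmul hzero
  refine (hle.trans_eq ?_).trans (Real.cosh_le_exp_half_sq (l * b))
  rw [hadd, Pi.add_apply, hsmul, Pi.smul_apply, hzero, condExp_const hm]
  simp

end Conditioning

section Martingale

variable {Ω : Type*} {mΩ : MeasurableSpace Ω} {P : Measure Ω} {ℱ : Filtration ℕ mΩ}

/-- `X 0, …, X (T - 1)` are martingale differences that are almost surely bounded by `b`. As for
the random inputs of the algorithms, `X t` is revealed in the step from `ℱ t` to `ℱ (t + 1)`. -/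
structure BoundedMartingaleDifferences (P : Measure Ω) (ℱ : Filtration ℕ mΩ) (T : ℕ) (b : ℝ)
    (X : ℕ → Ω → ℝ) : Prop where
  adapted : ∀ t < T, StronglyMeasurable[ℱ (t + 1)] (X t)
  bounded : ∀ t < T, ∀ᵐ ω ∂P, |X t ω| ≤ b
  condExp_eq_zero : ∀ t < T, P[X t | ℱ t] =ᵐ[P] 0

namespace BoundedMartingaleDifferences

variable {T : ℕ} {b : ℝ} {X : ℕ → Ω → ℝ}

lemma of_bounded [IsFiniteMeasure P] (hX : ∀ t < T, StronglyMeasurable[ℱ (t + 1)] (X t))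
    (hXb : ∀ t < T, ∀ᵐ ω ∂P, |X t ω| ≤ b) :
    BoundedMartingaleDifferences P ℱ T (2 * b) fun t => P[X t | ℱ t] - X t where
  adapted t ht := (stronglyMeasurable_condExp.mono (ℱ.mono t.le_succ)).sub (hX t ht)
  bounded t ht := by
    filter_upwards [hXb t ht, ae_bdd_abs_condExp_of_ae_bdd_abs (m := ℱ t) (hXb t ht)]
      with ω hXω hcondω
    calc |(P[X t | ℱ t] - X t) ω| ≤ |(P[X t | ℱ t]) ω| + |X t ω| := abs_sub _ _
      _ ≤ 2 * b := by linarith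
  condExp_eq_zero t ht := by
    have hintegrable : Integrable (X t) P :=
      integrable_of_ae_bound ((hX t ht).mono (ℱ.le _)).aestronglyMeasurable (hXb t ht)
    filter_upwards [condExp_sub (m := ℱ t) integrable_condExp hintegrable,
      condExp_condExp_of_le (f := X t) (μ := P) le_rfl (ℱ.le t)] with ω hsub hidem
    rw [hsub, Pi.sub_apply, hidem, sub_self, Pi.zero_apply]

lemma stronglyMeasurable_sum (hX : BoundedMartingaleDifferences P ℱ T b X) {n : ℕ} (hn : n ≤ T) :
    StronglyMeasurable[ℱ n] fun ω => ∑ t ∈ Finset.range n, X t ω := by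
  refine Finset.stronglyMeasurable_fun_sum _ fun t ht => ?_
  have ht := Finset.mem_range.1 ht
  exact (hX.adapted t (ht.trans_le hn)).mono (ℱ.mono ht)

lemma ae_abs_sum_le (hX : BoundedMartingaleDifferences P ℱ T b X) {n : ℕ} (hn : n ≤ T) :
    ∀ᵐ ω ∂P, |∑ t ∈ Finset.range n, X t ω| ≤ n * b := by
  have hall : ∀ᵐ ω ∂P, ∀ t ∈ Finset.range n, |X t ω| ≤ b :=
    (Finset.eventually_all _).2 fun t ht => hX.bounded t ((Finset.mem_range.1 ht).trans_le hn)
  filter_upwards [hall] with ω hω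
  calc |∑ t ∈ Finset.range n, X t ω| ≤ ∑ t ∈ Finset.range n, |X t ω| :=
        Finset.abs_sum_le_sum_abs _ _
    _ ≤ ∑ _t ∈ Finset.range n, b := Finset.sum_le_sum hω
    _ = n * b := by rw [Finset.sum_const, Finset.card_range, nsmul_eq_mul]

lemma integrable_exp_sum [IsFiniteMeasure P] (hX : BoundedMartingaleDifferences P ℱ T b X)
    (l : ℝ) {n : ℕ} (hn : n ≤ T) :
    Integrable (fun ω => Real.exp (l * ∑ t ∈ Finset.range n, X t ω)) P :=
  integrable_exp_mul_of_mem_Icc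
    ((hX.stronglyMeasurable_sum hn).mono (ℱ.le n)).measurable.aemeasurable
    ((hX.ae_abs_sum_le hn).mono fun _ => abs_le.1)

lemma integral_exp_sum_le [IsProbabilityMeasure P] (hX : BoundedMartingaleDifferences P ℱ T b X)
    (hb : 0 < b) (l : ℝ) {n : ℕ} (hn : n ≤ T) :
    ∫ ω, Real.exp (l * ∑ t ∈ Finset.range n, X t ω) ∂P ≤ Real.exp (n * (l * b) ^ 2 / 2) := by
  induction n with
  | zero => simp
  | succ n ih =>
    have hn' : n ≤ T := n.le_succ.trans hn
    have hpast := hX.integrable_exp_sum l hn'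
    set Z : Ω → ℝ := fun ω => Real.exp (l * ∑ t ∈ Finset.range n, X t ω)
    set Y : Ω → ℝ := fun ω => Real.exp (l * X n ω)
    have hsplit : (fun ω => Real.exp (l * ∑ t ∈ Finset.range (n + 1), X t ω)) = Z * Y :=
      funext fun ω => by rw [Finset.sum_range_succ, mul_add, Real.exp_add]; rfl
    have hZm : StronglyMeasurable[ℱ n] Z :=
      Real.continuous_exp.comp_stronglyMeasurable ((hX.stronglyMeasurable_sum hn').const_mul l)
    have hXm : AEStronglyMeasurable (X n) P :=
      ((hX.adapted n hn).mono (ℱ.le _)).aestronglyMeasurable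
    have hYi : Integrable Y P :=
      integrable_exp_mul_of_mem_Icc hXm.aemeasurable ((hX.bounded n hn).mono fun _ => abs_le.1)
    have hZY : Integrable (Z * Y) P := hsplit ▸ hX.integrable_exp_sum l hn
    have hcond : P[Z * Y | ℱ n] ≤ᵐ[P] fun ω => Z ω * Real.exp ((l * b) ^ 2 / 2) := by
      filter_upwards [condExp_mul_of_stronglyMeasurable_left hZm hZY hYi,
        condExp_exp_mul_le (ℱ.le n) hXm hb (hX.bounded n hn) (hX.condExp_eq_zero n hn) l]
        with ω hpull hle
      rw [hpull, Pi.mul_apply]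
      exact mul_le_mul_of_nonneg_left hle (Real.exp_pos _).le
    calc ∫ ω, Real.exp (l * ∑ t ∈ Finset.range (n + 1), X t ω) ∂P
        = ∫ ω, (P[Z * Y | ℱ n]) ω ∂P := by rw [hsplit, integral_condExp (ℱ.le n)]
      _ ≤ ∫ ω, Z ω * Real.exp ((l * b) ^ 2 / 2) ∂P :=
          integral_mono_ae integrable_condExp (hpast.mul_const _) hcond
      _ = (∫ ω, Z ω ∂P) * Real.exp ((l * b) ^ 2 / 2) := integral_mul_const _ _
      _ ≤ Real.exp (n * (l * b) ^ 2 / 2) * Real.exp ((l * b) ^ 2 / 2) := by gcongr; exact ih hn'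
      _ = Real.exp ((n + 1 : ℕ) * (l * b) ^ 2 / 2) := by
          rw [← Real.exp_add, Nat.cast_succ]; ring_nf

/-- The Azuma-Hoeffding inequality, proved here because Mathlib's version needs `Ω` to be a standard
Borel space. -/
lemma measureReal_sum_ge_le [IsProbabilityMeasure P] (hX : BoundedMartingaleDifferences P ℱ T b X)
    (hT : 0 < T) (hb : 0 < b) {L : ℝ} (hL : 0 ≤ L) :
    P.real {ω | b * Real.sqrt (2 * T * L) ≤ ∑ t ∈ Finset.range T, X t ω} ≤ Real.exp (-L) := by
  have : (0 : ℝ) < T := Nat.cast_pos.2 hT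
  set q := Real.sqrt (2 * T * L)
  have hq : q ^ 2 = 2 * T * L := Real.sq_sqrt (by positivity)
  refine (measure_ge_le_exp_mul_mgf (b * q) (t := q / (T * b)) (by positivity)
    (hX.integrable_exp_sum _ le_rfl)).trans ?_
  refine (mul_le_mul_of_nonneg_left (hX.integral_exp_sum_le hb _ le_rfl)
    (Real.exp_pos _).le).trans ?_
  rw [← Real.exp_add, Real.exp_le_exp]
  refine le_of_eq ?_
  calc -(q / (T * b)) * (b * q) + T * (q / (T * b) * b) ^ 2 / 2 = -(q ^ 2) / (2 * T) := by
        field_simp; ring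
    _ = -L := by rw [hq]; field_simp

end BoundedMartingaleDifferences

lemma measurableSet_biInter_Ico {B : ℕ → Set Ω} {a n : ℕ}
    (hB : ∀ t ∈ Finset.Ico a (a + n), MeasurableSet[ℱ (t + 1)] (B t)) :
    MeasurableSet[ℱ (a + n)] (⋂ t ∈ Finset.Ico a (a + n), B t) :=
  Finset.measurableSet_biInter _ fun t ht => ℱ.mono (Finset.mem_Ico.1 ht).2 _ (hB t ht)

lemma measureReal_biInter_Ico_eq_pow [IsProbabilityMeasure P] {B : ℕ → Set Ω} {r : ℝ} {a n : ℕ}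
    (hB : ∀ t ∈ Finset.Ico a (a + n), MeasurableSet[ℱ (t + 1)] (B t))
    (hr : ∀ t ∈ Finset.Ico a (a + n),
      P[(B t).indicator (fun _ => (1 : ℝ)) | ℱ t] =ᵐ[P] fun _ => r) :
    P.real (⋂ t ∈ Finset.Ico a (a + n), B t) = r ^ n := by
  induction n with
  | zero => simp
  | succ n ih =>
    have hIco : Finset.Ico a (a + (n + 1)) = insert (a + n) (Finset.Ico a (a + n)) := by
      ext t; simp only [Finset.mem_Ico, Finset.mem_insert]; omega
    rw [hIco] at hB hr ⊢
    obtain ⟨hBn, hB⟩ := Finset.forall_mem_insert _ _ _ |>.1 hB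
    obtain ⟨hrn, hr⟩ := Finset.forall_mem_insert _ _ _ |>.1 hr
    have hM := measurableSet_biInter_Ico hB
    have hcond := setIntegral_condExp (ℱ.le (a + n))
      ((integrable_const (1 : ℝ)).indicator (μ := P) (ℱ.le _ _ hBn)) hM
    rw [setIntegral_indicator (ℱ.le _ _ hBn),
      setIntegral_congr_ae (g := fun _ => r) (ℱ.le _ _ hM) (hrn.mono fun ω hω _ => hω)] at hcond
    simp only [integral_const, MeasurableSet.univ, measureReal_restrict_apply, Set.univ_inter,
      smul_eq_mul, mul_one] at hcond
    rw [Finset.set_biInter_insert, Set.inter_comm, ← hcond, ih hB hr, pow_succ]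

end Martingale

/-! ### Regret of the two players -/

section SubgradientDescent

variable {d : ℕ} {W : Set (E d)} {η G : ℝ}

lemma norm_proj_step_sub_le (hcv : Convex ℝ W) (hW : IsClosed W) (hη : 0 ≤ η) {w Δ : E d}
    (hw : w ∈ W) (hΔ : ‖Δ‖ ≤ G) : ‖proj W (w - η • Δ) - w‖ ≤ η * G := by
  refine (norm_proj_sub_le hcv hW _ hw).trans ?_
  rw [sub_sub_cancel_left, norm_neg, norm_smul, Real.norm_of_nonneg hη]
  gcongr

lemma inner_le_of_proj_step (hcv : Convex ℝ W) (hW : IsClosed W) (hη : 0 < η) {w Δ u : E d}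
    (hΔ : ‖Δ‖ ≤ G) (hu : u ∈ W) :
    inner ℝ Δ (w - u) ≤
      (‖w - u‖ ^ 2 - ‖proj W (w - η • Δ) - u‖ ^ 2) / (2 * η) + η * G ^ 2 / 2 := by
  have hproj : ‖proj W (w - η • Δ) - u‖ ^ 2 ≤ ‖w - η • Δ - u‖ ^ 2 := by
    gcongr
    exact norm_proj_sub_le hcv hW _ hu
  have hexpand : ‖w - η • Δ - u‖ ^ 2 =
      ‖w - u‖ ^ 2 - 2 * η * inner ℝ Δ (w - u) + η ^ 2 * ‖Δ‖ ^ 2 := by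
    rw [sub_right_comm, norm_sub_sq_real, real_inner_smul_right, norm_smul, Real.norm_eq_abs,
      mul_pow, sq_abs, real_inner_comm]
    ring
  have hΔ2 : η ^ 2 * ‖Δ‖ ^ 2 ≤ η ^ 2 * G ^ 2 := by gcongr
  rw [div_add' _ _ _ (by positivity), le_div_iff₀ (by positivity)]
  nlinarith

lemma sum_inner_le (hcv : Convex ℝ W) (hW : IsClosed W) (hη : 0 < η) {T : ℕ} {w Δ : ℕ → E d}
    (hw : ∀ t, w (t + 1) = proj W (w t - η • Δ t)) (hΔ : ∀ t < T, ‖Δ t‖ ≤ G) {u : E d}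
    (hu : u ∈ W) {D : ℝ} (hD : ‖w 0 - u‖ ≤ D) :
    ∑ t ∈ Finset.range T, inner ℝ (Δ t) (w t - u) ≤ D ^ 2 / (2 * η) + η * T * G ^ 2 / 2 := by
  calc ∑ t ∈ Finset.range T, inner ℝ (Δ t) (w t - u)
      ≤ ∑ t ∈ Finset.range T,
          ((‖w t - u‖ ^ 2 - ‖w (t + 1) - u‖ ^ 2) / (2 * η) + η * G ^ 2 / 2) :=
        Finset.sum_le_sum fun t ht =>
          hw t ▸ inner_le_of_proj_step hcv hW hη (hΔ t (Finset.mem_range.1 ht)) hu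
    _ = (‖w 0 - u‖ ^ 2 - ‖w T - u‖ ^ 2) / (2 * η) + η * T * G ^ 2 / 2 := by
        rw [Finset.sum_add_distrib, ← Finset.sum_div,
          Finset.sum_range_sub' (fun t => ‖w t - u‖ ^ 2), Finset.sum_const, Finset.card_range,
          nsmul_eq_mul]
        ring
    _ ≤ D ^ 2 / (2 * η) + η * T * G ^ 2 / 2 := by
        gcongr
        have hsq : ‖w 0 - u‖ ^ 2 ≤ D ^ 2 := by gcongr
        linarith [sq_nonneg ‖w T - u‖]

end SubgradientDescent

section FiniteHoeffding

variable {ι : Type*} [Fintype ι] {p : ι → ℝ}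

lemma abs_sum_mul_le (hp : ∀ j, 0 ≤ p j) (hp1 : ∑ j, p j = 1) {x : ι → ℝ} {B : ℝ}
    (hx : ∀ j, |x j| ≤ B) : |∑ j, p j * x j| ≤ B :=
  calc |∑ j, p j * x j| ≤ ∑ j, |p j * x j| := Finset.abs_sum_le_sum_abs _ _
    _ ≤ ∑ j, p j * B := Finset.sum_le_sum fun j _ => by
        rw [abs_mul, abs_of_nonneg (hp j)]
        exact mul_le_mul_of_nonneg_left (hx j) (hp j)
    _ = B := by rw [← Finset.sum_mul, hp1, one_mul]

lemma sum_mul_exp_le_of_sum_eq_zero (hp : ∀ j, 0 ≤ p j) (hp1 : ∑ j, p j = 1) {y : ι → ℝ} {b : ℝ}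
    (hb : 0 < b) (hy : ∀ j, |y j| ≤ b) (hy0 : ∑ j, p j * y j = 0) (η : ℝ) :
    ∑ j, p j * Real.exp (η * y j) ≤ Real.exp ((η * b) ^ 2 / 2) :=
  calc ∑ j, p j * Real.exp (η * y j)
      ≤ ∑ j, p j * (Real.cosh (η * b) + Real.sinh (η * b) / b * y j) :=
        Finset.sum_le_sum fun j _ =>
          mul_le_mul_of_nonneg_left (exp_mul_le_chord hb (hy j) η) (hp j)
    _ = (∑ j, p j) * Real.cosh (η * b) + Real.sinh (η * b) / b * ∑ j, p j * y j := by
        rw [Finset.sum_mul, Finset.mul_sum, ← Finset.sum_add_distrib]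
        exact Finset.sum_congr rfl fun j _ => by ring
    _ ≤ Real.exp ((η * b) ^ 2 / 2) := by
        rw [hp1, hy0, one_mul, mul_zero, add_zero]
        exact Real.cosh_le_exp_half_sq _

lemma sum_mul_exp_le (hp : ∀ j, 0 ≤ p j) (hp1 : ∑ j, p j = 1) {x : ι → ℝ} {B : ℝ} (hB : 0 < B)
    (hx : ∀ j, |x j| ≤ B) (η : ℝ) :
    ∑ j, p j * Real.exp (η * x j) ≤ Real.exp (η * ∑ j, p j * x j + 2 * η ^ 2 * B ^ 2) := by
  have haB := abs_sum_mul_le hp hp1 hx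
  set a := ∑ j, p j * x j with ha
  have hcentered := sum_mul_exp_le_of_sum_eq_zero hp hp1 (y := fun j => x j - a) (b := 2 * B)
    (by positivity) (fun j => (abs_sub _ _).trans (by linarith [hx j]))
    (by simp only [mul_sub, Finset.sum_sub_distrib, ← Finset.sum_mul, hp1, one_mul, ← ha,
      sub_self]) η
  calc ∑ j, p j * Real.exp (η * x j)
      = Real.exp (η * a) * ∑ j, p j * Real.exp (η * (x j - a)) := by
        rw [Finset.mul_sum]
        refine Finset.sum_congr rfl fun j _ => ?_
        rw [mul_left_comm, ← Real.exp_add]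
        ring_nf
    _ ≤ Real.exp (η * a) * Real.exp ((η * (2 * B)) ^ 2 / 2) := by gcongr
    _ = Real.exp (η * a + 2 * η ^ 2 * B ^ 2) := by rw [← Real.exp_add]; ring_nf

end FiniteHoeffding

section MultiplicativeWeights

variable {m : ℕ}

lemma sum_abs_exp_pos [NeZero m] (y : Fin m → ℝ) : 0 < ∑ l, |Real.exp (y l)| :=
  Finset.sum_pos (fun _ _ => abs_pos.2 (Real.exp_pos _).ne') Finset.univ_nonempty

lemma multUpdate_pos [NeZero m] (η : ℝ) (p x : Fin m → ℝ) (j : Fin m) : 0 < multUpdate η p x j :=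
  div_pos (Real.exp_pos _) (sum_abs_exp_pos _)

lemma sum_multUpdate [NeZero m] (η : ℝ) (p x : Fin m → ℝ) : ∑ j, multUpdate η p x j = 1 := by
  simp only [multUpdate, ← Finset.sum_div]
  rw [← Finset.sum_congr rfl fun l _ => Real.abs_exp (Real.log (p l) + η * x l)]
  exact div_self (sum_abs_exp_pos _).ne'

lemma le_log_multUpdate_sub_log [NeZero m] {p x : Fin m → ℝ} (hp : ∀ j, 0 < p j)
    (hp1 : ∑ j, p j = 1) {B : ℝ} (hB : 0 < B) (hx : ∀ j, |x j| ≤ B) (η : ℝ) (j : Fin m) :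
    η * (x j - ∑ l, p l * x l) ≤
      Real.log (multUpdate η p x j) - Real.log (p j) + 2 * η ^ 2 * B ^ 2 := by
  have hZ : ∑ l, |Real.exp (Real.log (p l) + η * x l)| = ∑ l, p l * Real.exp (η * x l) :=
    Finset.sum_congr rfl fun l _ => by rw [Real.abs_exp, Real.exp_add, Real.exp_log (hp l)]
  have hpos := sum_abs_exp_pos fun l => Real.log (p l) + η * x l
  have hlogZ := Real.log_le_log (hZ ▸ hpos) (sum_mul_exp_le (fun l => (hp l).le) hp1 hB hx η)
  rw [Real.log_exp] at hlogZ
  rw [multUpdate, Real.log_div (Real.exp_pos _).ne' hpos.ne', Real.log_exp, hZ]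
  linarith

lemma sum_sub_sum_mul_le {η B : ℝ} (hη : 0 < η) (hB : 0 < B) {p x : ℕ → Fin m → ℝ}
    (hp0 : ∀ j, 0 < p 0 j) (hp1 : ∑ j, p 0 j = 1) (hp : ∀ t, p (t + 1) = multUpdate η (p t) (x t))
    {T : ℕ} (hx : ∀ t < T, ∀ j, |x t j| ≤ B) (j : Fin m) :
    ∑ t ∈ Finset.range T, (x t j - ∑ l, p t l * x t l) ≤
      -Real.log (p 0 j) / η + 2 * η * T * B ^ 2 := by
  have : NeZero m := ⟨fun h => (h ▸ j).elim0⟩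
  have hdist : ∀ t, (∀ l, 0 < p t l) ∧ ∑ l, p t l = 1
    | 0 => ⟨hp0, hp1⟩
    | t + 1 => hp t ▸ ⟨multUpdate_pos _ _ _, sum_multUpdate _ _ _⟩
  have hlog : Real.log (p T j) ≤ 0 := by
    refine Real.log_nonpos ((hdist T).1 j).le ?_
    rw [← (hdist T).2]
    exact Finset.single_le_sum (fun l _ => ((hdist T).1 l).le) (Finset.mem_univ j)
  have hpotential : η * ∑ t ∈ Finset.range T, (x t j - ∑ l, p t l * x t l) ≤
      Real.log (p T j) - Real.log (p 0 j) + T * (2 * η ^ 2 * B ^ 2) := by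
    rw [Finset.mul_sum, ← Finset.sum_range_sub fun t => Real.log (p t j)]
    calc _ ≤ ∑ t ∈ Finset.range T,
          (Real.log (p (t + 1) j) - Real.log (p t j) + 2 * η ^ 2 * B ^ 2) :=
          Finset.sum_le_sum fun t ht => by
            rw [hp t]
            exact le_log_multUpdate_sub_log (hdist t).1 (hdist t).2 hB
              (hx t (Finset.mem_range.1 ht)) η j
      _ = _ := by
          rw [Finset.sum_add_distrib, Finset.sum_const, Finset.card_range, nsmul_eq_mul]
  rw [div_add' _ _ _ hη.ne', le_div_iff₀ hη]
  linarith

end MultiplicativeWeights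

/-- In the first `n` steps the initial value still serves. -/
lemma abs_sub_le_of_refreshed {u μ : ℕ → ℝ} {R : ℕ → Prop} {T : ℕ} {a : ℝ} (ha : 0 ≤ a)
    (hu : ∀ t < T, |u (t + 1) - u t| ≤ a) (hstart : μ 0 = u 0)
    (hrefresh : ∀ t, R t → μ (t + 1) = u t) (hkeep : ∀ t, ¬ R t → μ (t + 1) = μ t)
    {t n : ℕ} (ht : t ≤ T) (h : n < t → ∃ s ∈ Finset.Ico (t - n) t, R s) :
    |u t - μ t| ≤ n * a := by
  induction t generalizing n with
  | zero => rw [hstart, sub_self, abs_zero]; positivity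
  | succ t ih =>
    obtain ⟨n, rfl⟩ : ∃ n', n = n' + 1 := by
      refine Nat.exists_eq_succ_of_ne_zero fun hn => ?_
      obtain ⟨s, hs, -⟩ := h (by omega)
      rw [Finset.mem_Ico] at hs
      omega
    have hstep := hu t ht
    push_cast
    by_cases hR : R t
    · rw [hrefresh t hR]
      nlinarith [mul_nonneg (Nat.cast_nonneg (α := ℝ) n) ha]
    · have hprev : |u t - μ t| ≤ n * a := by
        refine ih (Nat.le_of_succ_le ht) fun hnt => ?_
        obtain ⟨s, hs, hRs⟩ := h (by omega)
        have hst : s ≠ t := fun hst => hR (hst ▸ hRs)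
        rw [Finset.mem_Ico] at hs
        exact ⟨s, Finset.mem_Ico.2 ⟨by omega, by omega⟩, hRs⟩
      rw [hkeep t hR]
      linarith [abs_sub_le (u (t + 1)) (u t) (μ t)]

section ConditionalSubgradients

variable {Ω : Type*} {m₀ mΩ : MeasurableSpace Ω} {P : Measure Ω} [IsFiniteMeasure P] {d : ℕ}
  {W : Set (E d)} {w : Ω → E d} {u : E d} {D : ℝ}

lemma sub_le_condExp_inner {f : E d → ℝ} (hm : m₀ ≤ mΩ) (hw : StronglyMeasurable[m₀] w)
    (hD : ∀ ω, ‖w ω - u‖ ≤ D) (hu : u ∈ W) {ξ : Ω → E d} (hξ : Integrable ξ P)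
    (hsub : ∀ᵐ ω ∂P, (P[ξ | m₀]) ω ∈ subdifferential W f (w ω)) :
    ∀ᵐ ω ∂P, f (w ω) - f u ≤ (P[fun ω => inner ℝ (ξ ω) (w ω - u) | m₀]) ω := by
  have hpull : P[fun ω => inner ℝ (w ω - u) (ξ ω) | m₀] =ᵐ[P]
      fun ω => inner ℝ (w ω - u) ((P[ξ | m₀]) ω) :=
    condExp_stronglyMeasurable_bilin_of_bound (innerSL ℝ) hm (hw.sub stronglyMeasurable_const) hξ D
      (ae_of_all _ hD)
  simp only [fun ω => real_inner_comm (w ω - u) (ξ ω)]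
  filter_upwards [hpull, hsub] with ω hpullω hsubω
  have hineq := hsubω u hu
  rw [← neg_sub, inner_neg_right, real_inner_comm] at hineq
  rw [hpullω]
  linarith

/-- `dg` selects measurable subgradients of norm at most `G` of each of the functions `φ j`. -/
structure SubgradientOracle {ι : Type*} (W : Set (E d)) (φ : ι → E d → ℝ) (dg : ι → E d → E d)
    (G : ℝ) : Prop where
  measurable : ∀ j, Measurable (dg j)
  mem_subdifferential : ∀ j, ∀ w ∈ W, dg j w ∈ subdifferential W (φ j) w
  norm_le : ∀ j, ∀ w ∈ W, ‖dg j w‖ ≤ G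

lemma SubgradientOracle.norm_add_smul_le {ι : Type*} {φ : ι → E d → ℝ} {dg : ι → E d → E d}
    {G Gf γ : ℝ} (hdg : SubgradientOracle W φ dg G) (hγ : 0 ≤ γ) (j : ι) {x v : E d} (hx : x ∈ W)
    (hv : ‖v‖ ≤ Gf) : ‖v + γ • dg j x‖ ≤ Gf + γ * G := by
  refine (norm_add_le _ _).trans (add_le_add hv ?_)
  rw [norm_smul, Real.norm_of_nonneg hγ]
  exact mul_le_mul_of_nonneg_left (hdg.norm_le j x hx) hγ

lemma sum_mul_sub_le_condExp_inner {ι : Type*} [Fintype ι] {φ : ι → E d → ℝ}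
    {dg : ι → E d → E d} {G : ℝ} (hdg : SubgradientOracle W φ dg G) (hm : m₀ ≤ mΩ)
    (hw : StronglyMeasurable[m₀] w) (hW : ∀ ω, w ω ∈ W) (hD : ∀ ω, ‖w ω - u‖ ≤ D) (hu : u ∈ W)
    {i : Ω → ι} (hi : ∀ j, MeasurableSet {ω | i ω = j}) {p : Ω → ι → ℝ}
    (hp : ∀ j, P[Set.indicator {ω | i ω = j} (fun _ => (1 : ℝ)) | m₀] =ᵐ[P] fun ω => p ω j) :
    ∀ᵐ ω ∂P, ∑ j, p ω j * (φ j (w ω) - φ j u) ≤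
      (P[fun ω => inner ℝ (dg (i ω) (w ω)) (w ω - u) | m₀]) ω := by
  have hp0 : ∀ j, ∀ᵐ ω ∂P, 0 ≤ p ω j := fun j => by
    filter_upwards [hp j, condExp_nonneg (m := m₀) (ae_of_all P fun ω =>
      Set.indicator_nonneg (s := {ω | i ω = j}) (fun _ _ => zero_le_one (α := ℝ)) ω)]
      with ω hω hpos using hω ▸ hpos
  have hcond := condExp_comp_index hm hi hp (Z := fun j ω => inner ℝ (dg j (w ω)) (w ω - u))
    (C := G * D)
    (fun j => ((hdg.measurable j).comp hw.measurable).stronglyMeasurable.inner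
      (hw.sub stronglyMeasurable_const))
    fun j => ae_of_all _ fun ω => (norm_inner_le_norm _ _).trans
      (mul_le_mul (hdg.norm_le j _ (hW ω)) (hD ω) (norm_nonneg _)
        ((norm_nonneg _).trans (hdg.norm_le j _ (hW ω))))
  filter_upwards [ae_all_iff.2 hp0, hcond] with ω hpω hcondω
  rw [hcondω]
  refine Finset.sum_le_sum fun j _ => mul_le_mul_of_nonneg_left ?_ (hpω j)
  have hineq := hdg.mem_subdifferential j _ (hW ω) u hu
  rw [← neg_sub, inner_neg_right] at hineq
  linarith

end ConditionalSubgradients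

section SampledDescent

variable {Ω : Type*} {mΩ : MeasurableSpace Ω} {P : Measure Ω} {ℱ : Filtration ℕ mΩ} {d m : ℕ}

lemma measurable_select {α β ι : Type*} {mα : MeasurableSpace α} [MeasurableSpace β] [Countable ι]
    {i : α → ι} (hi : ∀ j, MeasurableSet {a | i a = j}) {F : ι → α → β}
    (hF : ∀ j, Measurable (F j)) : Measurable fun a => F (i a) a := by
  intro s hs
  have hpre : (fun a => F (i a) a) ⁻¹' s = ⋃ j, {a | i a = j} ∩ F j ⁻¹' s := by
    ext a
    simp
  rw [hpre]
  exact MeasurableSet.iUnion fun j => (hi j).inter (hF j hs)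

/-- The common part of the two algorithms: `T` steps of projected stochastic subgradient descent
with directions `ξ t + γ • dg (i t) (w t)`, where `ξ t` is a stochastic subgradient of `f` and the
index `i t` has conditional law `p t` given the past. -/
structure SampledDescent (P : Measure Ω) (ℱ : Filtration ℕ mΩ) (W : Set (E d)) (f : E d → ℝ)
    (dg : Fin m → E d → E d) (Gf γ η : ℝ) (T : ℕ) (w ξ : ℕ → Ω → E d) (i : ℕ → Ω → Fin m)
    (p : ℕ → Ω → Fin m → ℝ) : Prop where
  measurable : ∀ t < T, Measurable[ℱ t] (w t)
  mem : ∀ t ω, w t ω ∈ W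
  subgradients : StochasticSubgradients P ℱ W f Gf T w ξ
  index_adapted : ∀ t < T, ∀ j, MeasurableSet[ℱ (t + 1)] {ω | i t ω = j}
  index_law : ∀ t < T, ∀ j, P[Set.indicator {ω | i t ω = j} (fun _ => (1 : ℝ)) | ℱ t] =ᵐ[P]
    fun ω => p t ω j
  step : ∀ t ω, w (t + 1) ω = proj W (w t ω - η • (ξ t ω + γ • dg (i t ω) (w t ω)))

namespace SampledDescent

variable {W : Set (E d)} {f : E d → ℝ} {φ : Fin m → E d → ℝ} {dg : Fin m → E d → E d}
  {D Gf Gg γ η : ℝ} {T : ℕ} {w ξ : ℕ → Ω → E d} {i : ℕ → Ω → Fin m} {p : ℕ → Ω → Fin m → ℝ}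
  {u : E d}

lemma norm_direction_le (h : SampledDescent P ℱ W f dg Gf γ η T w ξ i p)
    (hdg : SubgradientOracle W φ dg Gg) (hγ : 0 ≤ γ) :
    ∀ t < T, ∀ᵐ ω ∂P, ‖ξ t ω + γ • dg (i t ω) (w t ω)‖ ≤ Gf + γ * Gg := by
  intro t ht
  filter_upwards [h.subgradients.bounded t ht] with ω hω
  exact hdg.norm_add_smul_le hγ _ (h.mem t ω) hω

lemma abs_inner_direction_le (h : SampledDescent P ℱ W f dg Gf γ η T w ξ i p)
    (hdg : SubgradientOracle W φ dg Gg) (hγ : 0 ≤ γ)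
    (hD : ∀ x ∈ W, ∀ y ∈ W, ‖x - y‖ ≤ D) (hu : u ∈ W) :
    ∀ t < T, ∀ᵐ ω ∂P,
      |inner ℝ (ξ t ω + γ • dg (i t ω) (w t ω)) (w t ω - u)| ≤ (Gf + γ * Gg) * D := by
  intro t ht
  filter_upwards [h.norm_direction_le hdg hγ t ht] with ω hω
  exact (abs_real_inner_le_norm _ _).trans (mul_le_mul hω (hD _ (h.mem t ω) _ hu) (norm_nonneg _)
    ((norm_nonneg _).trans hω))

lemma stronglyMeasurable_inner_direction (h : SampledDescent P ℱ W f dg Gf γ η T w ξ i p)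
    (hdg : ∀ j, Measurable (dg j)) :
    ∀ t < T, StronglyMeasurable[ℱ (t + 1)] fun ω =>
      inner ℝ (ξ t ω + γ • dg (i t ω) (w t ω)) (w t ω - u) := by
  intro t ht
  have hw : Measurable[ℱ (t + 1)] (w t) := (h.measurable t ht).mono (ℱ.mono t.le_succ) le_rfl
  have hsel : Measurable[ℱ (t + 1)] fun ω => dg (i t ω) (w t ω) :=
    measurable_select (F := fun j ω => dg j (w t ω)) (h.index_adapted t ht)
      fun j => (hdg j).comp hw
  exact ((h.subgradients.adapted t ht).add (hsel.const_smul γ).stronglyMeasurable).inner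
    (hw.sub_const u).stronglyMeasurable

lemma sub_le_condExp_inner_direction [IsFiniteMeasure P]
    (h : SampledDescent P ℱ W f dg Gf γ η T w ξ i p)
    (hdg : SubgradientOracle W φ dg Gg) (hγ : 0 ≤ γ)
    (hD : ∀ x ∈ W, ∀ y ∈ W, ‖x - y‖ ≤ D) (hu : u ∈ W) {t : ℕ} (ht : t < T) :
    ∀ᵐ ω ∂P, f (w t ω) - f u + γ * ∑ j, p t ω j * (φ j (w t ω) - φ j u) ≤
      (P[fun ω => inner ℝ (ξ t ω + γ • dg (i t ω) (w t ω)) (w t ω - u) | ℱ t]) ω := by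
  have hw := (h.measurable t ht).stronglyMeasurable
  have hwu : ∀ ω, ‖w t ω - u‖ ≤ D := fun ω => hD _ (h.mem t ω) _ hu
  have hwum : StronglyMeasurable fun ω => w t ω - u :=
    (hw.mono (ℱ.le t)).sub stronglyMeasurable_const
  have hξm : StronglyMeasurable (ξ t) := (h.subgradients.adapted t ht).mono (ℱ.le _)
  have hξ : Integrable (ξ t) P :=
    integrable_of_ae_bound hξm.aestronglyMeasurable (h.subgradients.bounded t ht)
  have hi : ∀ j, MeasurableSet {ω | i t ω = j} := fun j => ℱ.le _ _ (h.index_adapted t ht j)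
  have hsel : Measurable fun ω => dg (i t ω) (w t ω) :=
    measurable_select (F := fun j ω => dg j (w t ω)) hi
      fun j => (hdg.measurable j).comp (hw.mono (ℱ.le t)).measurable
  have hintf : Integrable (fun ω => inner ℝ (ξ t ω) (w t ω - u)) P := by
    refine integrable_of_ae_bound (C := Gf * D) (hξm.inner hwum).aestronglyMeasurable ?_
    filter_upwards [h.subgradients.bounded t ht] with ω hω
    exact (norm_inner_le_norm _ _).trans
      (mul_le_mul hω (hwu ω) (norm_nonneg _) ((norm_nonneg _).trans hω))
  have hintg : Integrable (fun ω => inner ℝ (dg (i t ω) (w t ω)) (w t ω - u)) P :=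
    integrable_of_ae_bound (C := Gg * D) (hsel.stronglyMeasurable.inner hwum).aestronglyMeasurable
      (ae_of_all _ fun ω => (norm_inner_le_norm _ _).trans
        (mul_le_mul (hdg.norm_le _ _ (h.mem t ω)) (hwu ω) (norm_nonneg _)
          ((norm_nonneg _).trans (hdg.norm_le (i t ω) _ (h.mem t ω)))))
  have hsplit : (fun ω => inner ℝ (ξ t ω + γ • dg (i t ω) (w t ω)) (w t ω - u)) =
      (fun ω => inner ℝ (ξ t ω) (w t ω - u)) +
        γ • fun ω => inner ℝ (dg (i t ω) (w t ω)) (w t ω - u) := by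
    ext ω
    simp only [Pi.add_apply, Pi.smul_apply, smul_eq_mul, inner_add_left, real_inner_smul_left]
  rw [hsplit]
  filter_upwards [condExp_add hintf (hintg.smul γ) (ℱ t), condExp_smul (μ := P) γ
      (fun ω => inner ℝ (dg (i t ω) (w t ω)) (w t ω - u)) (ℱ t),
    sub_le_condExp_inner (ℱ.le t) hw hwu hu hξ (h.subgradients.unbiased t ht),
    sum_mul_sub_le_condExp_inner hdg (ℱ.le t) hw (h.mem t) hwu hu hi (h.index_law t ht)]
    with ω hadd hsmul hf hg
  rw [hadd, Pi.add_apply, hsmul, Pi.smul_apply, smul_eq_mul]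
  exact add_le_add hf (mul_le_mul_of_nonneg_left hg hγ)

lemma measureReal_regret_gt_le [IsProbabilityMeasure P]
    (h : SampledDescent P ℱ W f dg Gf γ η T w ξ i p)
    (hdg : SubgradientOracle W φ dg Gg) (hcv : Convex ℝ W) (hcl : IsClosed W) (hγ : 0 ≤ γ)
    (hη : 0 < η) (hT : 0 < T) (hD : ∀ x ∈ W, ∀ y ∈ W, ‖x - y‖ ≤ D) (hD0 : 0 < D)
    (hG : 0 < Gf + γ * Gg) (hu : u ∈ W) {L : ℝ} (hL : 0 ≤ L) :
    P.real {ω | D ^ 2 / (2 * η) + η * T * (Gf + γ * Gg) ^ 2 / 2 +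
        2 * ((Gf + γ * Gg) * D) * √(2 * T * L) <
      ∑ t ∈ Finset.range T,
        (f (w t ω) - f u + γ * ∑ j, p t ω j * (φ j (w t ω) - φ j u))} ≤ Real.exp (-L) := by
  set A : ℕ → Ω → ℝ := fun t ω => inner ℝ (ξ t ω + γ • dg (i t ω) (w t ω)) (w t ω - u)
  have hmart := BoundedMartingaleDifferences.of_bounded
    (h.stronglyMeasurable_inner_direction hdg.measurable)
    (h.abs_inner_direction_le hdg hγ hD hu)
  refine le_trans (ENNReal.toReal_mono (measure_ne_top _ _) (measure_mono_ae ?_))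
    (hmart.measureReal_sum_ge_le hT (by positivity) hL)
  have hdir : ∀ᵐ ω ∂P, ∀ t ∈ Finset.range T,
      ‖ξ t ω + γ • dg (i t ω) (w t ω)‖ ≤ Gf + γ * Gg :=
    (Finset.eventually_all _).2 fun t ht => h.norm_direction_le hdg hγ t (Finset.mem_range.1 ht)
  have hmean : ∀ᵐ ω ∂P, ∀ t ∈ Finset.range T,
      f (w t ω) - f u + γ * ∑ j, p t ω j * (φ j (w t ω) - φ j u) ≤ (P[A t | ℱ t]) ω :=
    (Finset.eventually_all _).2 fun t ht =>
      h.sub_le_condExp_inner_direction hdg hγ hD hu (Finset.mem_range.1 ht)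
  filter_upwards [hdir, hmean] with ω hdirω hmeanω
  intro (hgt : _ < _)
  have hlin : ∑ t ∈ Finset.range T, A t ω ≤
      D ^ 2 / (2 * η) + η * T * (Gf + γ * Gg) ^ 2 / 2 :=
    sum_inner_le hcv hcl hη (fun t => h.step t ω)
      (fun t ht => hdirω t (Finset.mem_range.2 ht)) hu (hD _ (h.mem 0 ω) _ hu)
  change 2 * ((Gf + γ * Gg) * D) * √(2 * T * L) ≤ ∑ t ∈ Finset.range T, (P[A t | ℱ t] - A t) ω
  have hsum := Finset.sum_le_sum hmeanω
  simp only [Pi.sub_apply, Finset.sum_sub_distrib]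
  linarith

end SampledDescent

end SampledDescent

/-- The assumptions on the constraints: a closed convex domain `W` of diameter at most `D`,
`Lg`-Lipschitz constraints `g j`, and an oracle for subgradients of norm at most `Gg` of their
positive parts. -/
structure ConstraintData {d m : ℕ} (W : Set (E d)) (g : Fin m → E d → ℝ) (dg : Fin m → E d → E d)
    (Lg : ℝ≥0) (D Gg : ℝ) : Prop where
  convex : Convex ℝ W
  isClosed : IsClosed W
  diam : ∀ w ∈ W, ∀ w' ∈ W, ‖w - w'‖ ≤ D
  lipschitz : ∀ j, LipschitzOnWith Lg (g j) W
  oracle : SubgradientOracle W (fun j x => max 0 (g j x)) dg Gg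

namespace ConstraintData

variable {d m : ℕ} {W : Set (E d)} {g : Fin m → E d → ℝ} {dg : Fin m → E d → E d} {Lg : ℝ≥0}
  {D Gg : ℝ}

lemma abs_max_zero_sub_le (hd : ConstraintData W g dg Lg D Gg) (j : Fin m) {x y : E d}
    (hx : x ∈ W) (hy : y ∈ W) : |max 0 (g j x) - max 0 (g j y)| ≤ Lg * ‖x - y‖ := by
  rw [max_comm 0, max_comm 0, ← dist_eq_norm]
  exact (abs_max_sub_max_le_abs _ _ _).trans ((hd.lipschitz j).dist_le_mul x hx y hy)

lemma max_zero_le (hd : ConstraintData W g dg Lg D Gg) (j : Fin m) {x u : E d} (hx : x ∈ W)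
    (hu : u ∈ feasible W g) : max 0 (g j x) ≤ Lg * D := by
  have hxu := hd.abs_max_zero_sub_le j hx hu.1
  rw [max_eq_left (hu.2 j), sub_zero] at hxu
  exact (le_abs_self _).trans (hxu.trans (by gcongr; exact hd.diam _ hx _ hu.1))

lemma measurable_comp (hd : ConstraintData W g dg Lg D Gg) {Ω : Type*} {mΩ : MeasurableSpace Ω}
    {w : Ω → E d} (hw : Measurable w) (hW : ∀ ω, w ω ∈ W) (j : Fin m) :
    Measurable fun ω => g j (w ω) := by
  obtain ⟨g', hg', heq⟩ := (hd.lipschitz j).extend_real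
  rw [show (fun ω => g j (w ω)) = fun ω => g' (w ω) from funext fun ω => heq (hW ω)]
  exact hg'.continuous.measurable.comp hw

lemma measurable_proj_step (hd : ConstraintData W g dg Lg D Gg) {Ω : Type*}
    {mΩ : MeasurableSpace Ω} {w ξ : Ω → E d} {i : Ω → Fin m} (γ η : ℝ) (hne : W.Nonempty)
    (hw : Measurable w) (hξ : Measurable ξ) (hi : ∀ j, MeasurableSet {ω | i ω = j}) :
    Measurable fun ω => proj W (w ω - η • (ξ ω + γ • dg (i ω) (w ω))) := by
  have hsel : Measurable fun ω => dg (i ω) (w ω) :=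
    measurable_select (F := fun j ω => dg j (w ω)) hi fun j => (hd.oracle.measurable j).comp hw
  exact (continuous_proj hd.convex hd.isClosed hne).measurable.comp
    (hw.sub ((hξ.add (hsel.const_smul γ)).const_smul η))

end ConstraintData

section Supergradient

variable {m : ℕ}

lemma supergradient_congr {γ : ℝ} {k : ℕ} {S : Finset (Fin m)} {v v' μ : Fin m → ℝ}
    (h : ∀ j ∈ S, v j = v' j) : supergradient γ k S v μ = supergradient γ k S v' μ := by
  funext j
  unfold supergradient
  split_ifs with hj
  · rw [h j hj]
  · rfl

lemma abs_supergradient_le {γ a c : ℝ} (hγ : 0 ≤ γ) (k : ℕ) (S : Finset (Fin m))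
    {v μ : Fin m → ℝ} {j : Fin m} (hμ0 : 0 ≤ μ j) (hμ : μ j ≤ a) (hv : |max 0 (v j) - μ j| ≤ c) :
    |supergradient γ k S v μ j| ≤ γ * a + γ * m / k * c := by
  unfold supergradient
  refine (abs_add_le _ _).trans (add_le_add ?_ ?_)
  · rw [abs_of_nonneg (mul_nonneg hγ hμ0)]
    gcongr
  · rw [abs_mul, abs_of_nonneg (show 0 ≤ γ * m / k by positivity)]
    gcongr
    split_ifs
    · exact hv
    · exact abs_zero.trans_le ((abs_nonneg _).trans hv)

lemma measurableSet_mem_of_forall_eq {Ω : Type*} {_ : MeasurableSpace Ω}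
    {S : Ω → Finset (Fin m)} (hS : ∀ A, MeasurableSet {ω | S ω = A}) (j : Fin m) :
    MeasurableSet {ω | j ∈ S ω} := by
  have hunion : {ω | j ∈ S ω} = ⋃ A : {A : Finset (Fin m) // j ∈ A}, {ω | S ω = A} := by
    ext ω
    simp
  rw [hunion]
  exact MeasurableSet.iUnion fun A => hS A

lemma measurable_supergradient {Ω : Type*} {_ : MeasurableSpace Ω} (γ : ℝ) (k : ℕ)
    {S : Ω → Finset (Fin m)} {v μ : Ω → Fin m → ℝ} (hS : ∀ A, MeasurableSet {ω | S ω = A})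
    (hv : ∀ j, Measurable fun ω => v ω j) (hμ : ∀ j, Measurable fun ω => μ ω j) (j : Fin m) :
    Measurable fun ω => supergradient γ k (S ω) (v ω) (μ ω) j :=
  ((hμ j).const_mul γ).add (Measurable.const_mul (Measurable.ite
    (measurableSet_mem_of_forall_eq hS j) ((measurable_const.max (hv j)).sub (hμ j))
    measurable_const) _)

lemma measurable_multUpdate {Ω : Type*} {_ : MeasurableSpace Ω} (η : ℝ) {p x : Ω → Fin m → ℝ}
    (hp : ∀ j, Measurable fun ω => p ω j) (hx : ∀ j, Measurable fun ω => x ω j) (j : Fin m) :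
    Measurable fun ω => multUpdate η (p ω) (x ω) j := by
  have hexp : ∀ j, Measurable fun ω => Real.exp (Real.log (p ω j) + η * x ω j) := fun j => by
    have := hp j
    have := hx j
    fun_prop
  exact (hexp j).div (Finset.measurable_fun_sum _ fun l _ => (hexp l).abs)

end Supergradient

namespace LightExecution

variable {Ω : Type*} {mΩ : MeasurableSpace Ω} {P : Measure Ω} {ℱ : Filtration ℕ mΩ} {d m : ℕ}
  {W : Set (E d)} {f : E d → ℝ} {g : Fin m → E d → ℝ} {dg : Fin m → E d → E d} {Lg : ℝ≥0}
  {D Gf Gg γ η : ℝ} {k T : ℕ} {w₁ : Ω → E d} {ξ : ℕ → Ω → E d} {i : ℕ → Ω → Fin m}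
  {S : ℕ → Ω → Finset (Fin m)} {u : E d}

/-- The random state of LightTouch after `t` iterations. The execution `_h` only serves to supply
the parameters of the algorithm. -/
noncomputable def state (_h : LightExecution P ℱ W f g dg Gf γ η k T w₁ ξ i S) (t : ℕ) (ω : Ω) :
    State d m :=
  (lightIter W g dg γ η k (w₁ ω) (fun s => ξ s ω) (fun s => i s ω) (fun s => S s ω) t).val

variable (h : LightExecution P ℱ W f g dg Gf γ η k T w₁ ξ i S)
include h

lemma state_zero (ω : Ω) : h.state 0 ω =
    { w := w₁ ω, p := fun _ => 1 / (m : ℝ), μ := fun j => max 0 (g j (w₁ ω)) } := by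
  have hstart : h.state 0 ω =
    { w := w₁ ω
      p := fun _ => 1 / (m : ℝ)
      μ := fun j => max 0 (if j ∈ Finset.univ then g j (w₁ ω) else 0) } := rfl
  simpa only [Finset.mem_univ, if_true] using hstart

lemma state_succ (t : ℕ) (ω : Ω) : h.state (t + 1) ω =
    { w := proj W ((h.state t ω).w - η • (ξ t ω + γ • dg (i t ω) (h.state t ω).w))
      p := multUpdate η (h.state t ω).p
        (supergradient γ k (S t ω) (fun j => g j (h.state t ω).w) (h.state t ω).μ)
      μ := fun j => if j ∈ S t ω then max 0 (g j (h.state t ω).w) else (h.state t ω).μ j } := by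
  have hstep : h.state (t + 1) ω =
    { w := proj W ((h.state t ω).w - η • (ξ t ω + γ • dg (i t ω) (h.state t ω).w))
      p := multUpdate η (h.state t ω).p (supergradient γ k (S t ω)
        (fun j => if j ∈ S t ω then g j (h.state t ω).w else 0) (h.state t ω).μ)
      μ := fun j => if j ∈ S t ω then max 0 (if j ∈ S t ω then g j (h.state t ω).w else 0)
        else (h.state t ω).μ j } := rfl
  rw [hstep, supergradient_congr fun j hj => if_pos hj]
  congr 1
  funext j
  split_ifs <;> rfl

lemma checks_eq (ω : Ω) {t : ℕ} (ht : t ≤ T) :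
    (lightIter W g dg γ η k (w₁ ω) (fun s => ξ s ω) (fun s => i s ω) (fun s => S s ω) t).checks
      = m + t * (1 + k) := by
  induction t with
  | zero =>
    have hstart : (lightIter W g dg γ η k (w₁ ω) (fun s => ξ s ω) (fun s => i s ω)
      (fun s => S s ω) 0).checks = (∑ _j : Fin m, 1) + 0 := rfl
    simp [hstart]
  | succ t ih =>
    have hstep : (lightIter W g dg γ η k (w₁ ω) (fun s => ξ s ω) (fun s => i s ω)
        (fun s => S s ω) (t + 1)).checks =
      (lightIter W g dg γ η k (w₁ ω) (fun s => ξ s ω) (fun s => i s ω)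
        (fun s => S s ω) t).checks + (1 + ((∑ _j ∈ S t ω, 1) + 0)) := rfl
    rw [hstep, ih (t.le_succ.trans ht), Finset.sum_const, smul_eq_mul, mul_one,
      h.batch_card t ht ω]
    ring

lemma w_mem (hW : IsClosed W) (t : ℕ) (ω : Ω) : (h.state t ω).w ∈ W := by
  cases t with
  | zero => exact h.state_zero ω ▸ h.init_mem ω
  | succ t => exact h.state_succ t ω ▸ proj_mem hW ⟨_, h.init_mem ω⟩ _

lemma p_pos [NeZero m] (t : ℕ) (ω : Ω) (j : Fin m) : 0 < (h.state t ω).p j := by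
  cases t with
  | zero =>
    rw [h.state_zero]
    exact one_div_pos.2 (Nat.cast_pos.2 (NeZero.pos m))
  | succ t => exact h.state_succ t ω ▸ multUpdate_pos _ _ _ _

lemma sum_p [NeZero m] (t : ℕ) (ω : Ω) : ∑ j, (h.state t ω).p j = 1 := by
  cases t with
  | zero => simp [h.state_zero, NeZero.ne m]
  | succ t => exact h.state_succ t ω ▸ sum_multUpdate _ _ _

lemma μ_mem_Icc (hd : ConstraintData W g dg Lg D Gg) (hu : u ∈ feasible W g) (t : ℕ) (ω : Ω)
    (j : Fin m) : (h.state t ω).μ j ∈ Set.Icc 0 (Lg * D) := by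
  induction t with
  | zero => exact h.state_zero ω ▸ ⟨le_max_left _ _, hd.max_zero_le j (h.init_mem ω) hu⟩
  | succ t ih =>
    rw [h.state_succ]
    dsimp only
    split_ifs
    · exact ⟨le_max_left _ _, hd.max_zero_le j (h.w_mem hd.isClosed t ω) hu⟩
    · exact ih

lemma measurable_state (hd : ConstraintData W g dg Lg D Gg) (hne : W.Nonempty) {t : ℕ}
    (ht : t ≤ T) :
    Measurable[ℱ t] (fun ω => (h.state t ω).w) ∧
    (∀ j, Measurable[ℱ t] fun ω => (h.state t ω).p j) ∧
    ∀ j, Measurable[ℱ t] fun ω => (h.state t ω).μ j := by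
  induction t with
  | zero =>
    have hw₁ := h.init_measurable.measurable
    simp only [h.state_zero]
    exact ⟨hw₁, fun _ => measurable_const,
      fun j => measurable_const.max (hd.measurable_comp hw₁ h.init_mem j)⟩
  | succ t ih =>
    obtain ⟨hw, hp, hμ⟩ := ih (t.le_succ.trans ht)
    have hle : ℱ t ≤ ℱ (t + 1) := ℱ.mono t.le_succ
    replace hw := hw.mono hle le_rfl
    replace hμ := fun j => (hμ j).mono hle le_rfl
    have hg := hd.measurable_comp hw (h.w_mem hd.isClosed t)
    simp only [h.state_succ]
    refine ⟨hd.measurable_proj_step γ η hne hw (h.subgradients.adapted t ht).measurable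
      (h.index_adapted t ht), ?_, fun j => ?_⟩
    · exact measurable_multUpdate η (fun j => (hp j).mono hle le_rfl)
        (measurable_supergradient γ k (h.batch_adapted t ht) hg hμ)
    · exact Measurable.ite (measurableSet_mem_of_forall_eq (h.batch_adapted t ht) j)
        (measurable_const.max (hg j)) (hμ j)

lemma sampledDescent (hd : ConstraintData W g dg Lg D Gg) (hne : W.Nonempty) :
    SampledDescent P ℱ W f dg Gf γ η T (fun t ω => (h.state t ω).w) ξ i
      (fun t ω => (h.state t ω).p) where
  measurable _ ht := (h.measurable_state hd hne ht.le).1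
  mem := h.w_mem hd.isClosed
  subgradients := h.subgradients
  index_adapted := h.index_adapted
  index_law := h.index_law
  step t ω := by rw [h.state_succ]

lemma abs_max_zero_sub_μ_le (hd : ConstraintData W g dg Lg D Gg) (hγ : 0 ≤ γ) (hη : 0 ≤ η) {ω : Ω}
    (hξ : ∀ t < T, ‖ξ t ω‖ ≤ Gf) {t n : ℕ} (ht : t < T) (j : Fin m)
    (hrefreshed : n < t → ∃ s ∈ Finset.Ico (t - n) t, j ∈ S s ω) :
    |max 0 (g j (h.state t ω).w) - (h.state t ω).μ j| ≤ n * (Lg * (η * (Gf + γ * Gg))) := by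
  have hW := h.w_mem hd.isClosed
  have hdir : ∀ t < T, ‖ξ t ω + γ • dg (i t ω) (h.state t ω).w‖ ≤ Gf + γ * Gg := fun t ht =>
    hd.oracle.norm_add_smul_le hγ _ (hW t ω) (hξ t ht)
  have hG : 0 ≤ Gf + γ * Gg := (norm_nonneg _).trans (hdir t ht)
  refine abs_sub_le_of_refreshed (u := fun t => max 0 (g j (h.state t ω).w))
    (μ := fun t => (h.state t ω).μ j) (R := fun t => j ∈ S t ω) (T := T) (by positivity)
    (fun t ht => ?_) ?_ (fun t hR => ?_) (fun t hR => ?_) ht.le hrefreshed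
  · refine (hd.abs_max_zero_sub_le j (hW _ ω) (hW _ ω)).trans ?_
    gcongr
    rw [h.state_succ]
    exact norm_proj_step_sub_le hd.convex hd.isClosed hη (hW t ω) (hdir t ht)
  · simp only [h.state_zero]
  · simp only [h.state_succ, if_pos hR]
  · simp only [h.state_succ, if_neg hR]

end LightExecution

/-! ### Noise of the weight updates -/

section Batches

variable {m k : ℕ}

lemma cast_choose_pred [NeZero m] (hk : k ≤ m) :
    ((m - 1).choose k : ℝ) = m.choose k * (1 - k / m) := by
  obtain ⟨n, rfl⟩ : ∃ n, m = n + 1 := Nat.exists_eq_succ_of_ne_zero (NeZero.ne m)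
  have h : ((n.choose k * (n + 1) : ℕ) : ℝ) = ((n + 1).choose k * (n + 1 - k) : ℕ) := by
    rw [Nat.choose_mul_succ_eq]
  have hn : (0 : ℝ) < (n + 1 : ℕ) := by positivity
  rw [Nat.cast_mul, Nat.cast_mul, Nat.cast_sub hk] at h
  rw [Nat.add_sub_cancel, one_sub_div hn.ne', mul_div_assoc', eq_div_iff hn.ne', h]

lemma sum_powersetCard_notMem [NeZero m] (hk : k ≤ m) (j : Fin m) :
    ∑ A ∈ Finset.univ.powersetCard k, (if j ∈ A then 0 else 1 : ℝ) =
      m.choose k * (1 - k / m) := by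
  have hfilter : {A ∈ (Finset.univ : Finset (Fin m)).powersetCard k | j ∉ A} =
      (Finset.univ.erase j).powersetCard k := by
    ext A
    simp [Finset.mem_powersetCard, Finset.subset_erase, and_comm]
  simp_rw [← ite_not (j ∈ _)]
  rw [Finset.sum_boole, hfilter, Finset.card_powersetCard,
    Finset.card_erase_of_mem (Finset.mem_univ j), Finset.card_fin, cast_choose_pred hk]

lemma sum_powersetCard_one_sub_div_mul_mem (hk0 : 0 < k) (hk : k ≤ m) (j : Fin m) :
    ∑ A ∈ Finset.univ.powersetCard k, (1 - (m : ℝ) / k * if j ∈ A then 1 else 0) = 0 := by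
  have : NeZero m := ⟨(hk0.trans_le hk).ne'⟩
  have hsplit (A : Finset (Fin m)) : (1 - (m : ℝ) / k * if j ∈ A then 1 else 0) =
      1 - (m : ℝ) / k + m / k * if j ∈ A then 0 else 1 := by
    split_ifs <;> ring
  have hm : (m : ℝ) ≠ 0 := NeZero.ne _
  have hk' : (k : ℝ) ≠ 0 := Nat.cast_ne_zero.2 hk0.ne'
  rw [Finset.sum_congr rfl fun A _ => hsplit A, Finset.sum_add_distrib, ← Finset.mul_sum,
    sum_powersetCard_notMem hk, Finset.sum_const, Finset.card_powersetCard, Finset.card_fin,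
    nsmul_eq_mul]
  field_simp
  ring

end Batches

section SamplingNoise

variable {m k : ℕ} {γ c : ℝ} {p e : Fin m → ℝ}

lemma sum_abs_ite_sub_le_two (hp : ∀ l, 0 ≤ p l) (hp1 : ∑ l, p l = 1) (j : Fin m) :
    ∑ l, |(if l = j then 1 else 0) - p l| ≤ 2 := by
  calc ∑ l, |(if l = j then 1 else 0) - p l| ≤ ∑ l, ((if l = j then 1 else 0) + p l) :=
        Finset.sum_le_sum fun l _ => by
          refine (abs_sub _ _).trans_eq ?_
          rw [abs_of_nonneg (hp l)]
          split_ifs <;> simp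
    _ = 2 := by rw [Finset.sum_add_distrib, hp1]; norm_num

/-- The sampling error in the comparison of constraint `j` with the mixture `p`: what the
supergradient computed from the minibatch `A` misses of `γ (max(0, g_j) - ∑ l, p l max(0, g_l))`
when the remembered values fall short of the `max(0, g_l)` by `e l`. -/
noncomputable def samplingNoise (γ : ℝ) (k : ℕ) (p e : Fin m → ℝ) (j : Fin m)
    (A : Finset (Fin m)) : ℝ :=
  ∑ l, ((if l = j then 1 else 0) - p l) * (γ * e l * (1 - (m : ℝ) / k * if l ∈ A then 1 else 0))

lemma mul_max_zero_sub_sum_eq (γ : ℝ) (k : ℕ) (A : Finset (Fin m)) (v μ p : Fin m → ℝ)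
    (j : Fin m) :
    γ * (max 0 (v j) - ∑ l, p l * max 0 (v l)) =
      supergradient γ k A v μ j - ∑ l, p l * supergradient γ k A v μ l +
        samplingNoise γ k p (fun l => max 0 (v l) - μ l) j A := by
  have hsplit (l : Fin m) : γ * max 0 (v l) = supergradient γ k A v μ l +
      γ * (max 0 (v l) - μ l) * (1 - (m : ℝ) / k * if l ∈ A then 1 else 0) := by
    unfold supergradient
    split_ifs <;> ring
  rw [mul_sub, Finset.mul_sum, Finset.sum_congr rfl fun l _ => mul_left_comm γ (p l) _]
  simp only [hsplit, samplingNoise, sub_mul, mul_add, Finset.sum_sub_distrib,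
    Finset.sum_add_distrib, ite_mul, one_mul, zero_mul, Finset.sum_ite_eq', Finset.mem_univ,
    if_true]
  ring

lemma sum_powersetCard_samplingNoise (hk0 : 0 < k) (hk : k ≤ m) (γ : ℝ) (p e : Fin m → ℝ)
    (j : Fin m) : ∑ A ∈ Finset.univ.powersetCard k, samplingNoise γ k p e j A = 0 := by
  unfold samplingNoise
  rw [Finset.sum_comm]
  refine Finset.sum_eq_zero fun l _ => ?_
  rw [← Finset.mul_sum, ← Finset.mul_sum, sum_powersetCard_one_sub_div_mul_mem hk0 hk, mul_zero,
    mul_zero]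

lemma abs_samplingNoise_le (hγ : 0 ≤ γ) (hk0 : 0 < k) (hk : k ≤ m) (hp : ∀ l, 0 ≤ p l)
    (hp1 : ∑ l, p l = 1) (he : ∀ l, |e l| ≤ c) (j : Fin m) (A : Finset (Fin m)) :
    |samplingNoise γ k p e j A| ≤ 2 * (γ * m / k * c) := by
  have hmk : 1 ≤ (m : ℝ) / k := (one_le_div (Nat.cast_pos.2 hk0)).2 (Nat.cast_le.2 hk)
  have hV (l : Fin m) : |1 - (m : ℝ) / k * if l ∈ A then 1 else 0| ≤ m / k := by
    rw [abs_le]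
    split_ifs <;> constructor <;> linarith
  have hc : 0 ≤ c := (abs_nonneg _).trans (he j)
  calc |samplingNoise γ k p e j A|
      ≤ ∑ l, |(if l = j then 1 else 0) - p l| * (γ * m / k * c) := by
        refine (Finset.abs_sum_le_sum_abs _ _).trans (Finset.sum_le_sum fun l _ => ?_)
        rw [abs_mul]
        gcongr
        calc |γ * e l * (1 - (m : ℝ) / k * if l ∈ A then 1 else 0)| ≤ γ * c * (m / k) := by
              rw [abs_mul, abs_mul, abs_of_nonneg hγ]
              gcongr
              exacts [he l, hV l]
          _ = γ * m / k * c := by ring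
    _ ≤ 2 * (γ * m / k * c) := by
        rw [← Finset.sum_mul]
        gcongr
        exact sum_abs_ite_sub_le_two hp hp1 j

end SamplingNoise

namespace LightExecution

variable {Ω : Type*} {mΩ : MeasurableSpace Ω} {P : Measure Ω} {ℱ : Filtration ℕ mΩ} {d m : ℕ}
  {W : Set (E d)} {f : E d → ℝ} {g : Fin m → E d → ℝ} {dg : Fin m → E d → E d} {Lg : ℝ≥0}
  {D Gf Gg γ η : ℝ} {k T : ℕ} {w₁ : Ω → E d} {ξ : ℕ → Ω → E d} {i : ℕ → Ω → Fin m}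
  {S : ℕ → Ω → Finset (Fin m)} {u : E d} {t n : ℕ} {ω : Ω} {b c L : ℝ}

section BatchLaw

variable [IsProbabilityMeasure P] (h : LightExecution P ℱ W f g dg Gf γ η k T w₁ ξ i S)
include h

lemma condExp_comp_batch {t : ℕ} (ht : t < T) {Z : Finset (Fin m) → Ω → ℝ}
    (hZ : ∀ A, StronglyMeasurable[ℱ t] (Z A)) {C : ℝ} (hC : ∀ A ω, |Z A ω| ≤ C) :
    P[fun ω => Z (S t ω) ω | ℱ t] =ᵐ[P]
      fun ω => (∑ A ∈ Finset.univ.powersetCard k, Z A ω) / m.choose k := by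
  have hlaw (A : Finset (Fin m)) :
      P[Set.indicator {ω | S t ω = A} (fun _ => (1 : ℝ)) | ℱ t] =ᵐ[P]
        fun _ => if A.card = k then 1 / (m.choose k : ℝ) else 0 := by
    split_ifs with hA
    · exact h.batch_law t ht A hA
    · have hempty : {ω | S t ω = A} = ∅ :=
        Set.eq_empty_of_forall_notMem fun ω (hω : S t ω = A) => hA (hω ▸ h.batch_card t ht ω)
      rw [hempty, Set.indicator_empty]
      exact (condExp_zero (μ := P)).eventuallyEq
  filter_upwards [condExp_comp_index (ℱ.le t)
    (fun A => ℱ.le (t + 1) _ (h.batch_adapted t ht A)) hlaw hZ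
    fun A => ae_of_all P (hC A)] with ω hω
  simp only [hω, ite_mul, zero_mul, Finset.sum_div, one_div_mul_eq_div]
  rw [← Finset.sum_filter]
  congr 1
  ext A
  simp [Finset.mem_powersetCard]

variable [NeZero m]

lemma condExp_notMem_batch (hk : k ≤ m) {t : ℕ} (ht : t < T) (j : Fin m) :
    P[Set.indicator {ω | j ∉ S t ω} (fun _ => (1 : ℝ)) | ℱ t] =ᵐ[P] fun _ => 1 - (k : ℝ) / m := by
  have hind : Set.indicator {ω | j ∉ S t ω} (fun _ => (1 : ℝ)) =
      fun ω => if j ∈ S t ω then 0 else 1 := by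
    ext ω
    by_cases hj : j ∈ S t ω <;> simp [Set.indicator, hj]
  rw [hind]
  filter_upwards [h.condExp_comp_batch ht (Z := fun A _ => if j ∈ A then 0 else 1) (C := 1)
    (fun A => stronglyMeasurable_const) fun A _ => by split_ifs <;> simp] with ω hω
  have : (m.choose k : ℝ) ≠ 0 := Nat.cast_ne_zero.2 (Nat.choose_pos hk).ne'
  rw [hω, sum_powersetCard_notMem hk]
  field_simp

lemma measureReal_forall_notMem_Ico_le (hk : k ≤ m) (a n : ℕ) (j : Fin m) :
    P.real {ω | a + n < T ∧ ∀ s ∈ Finset.Ico a (a + n), j ∉ S s ω} ≤ (1 - (k : ℝ) / m) ^ n := by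
  by_cases ha : a + n < T
  · have hlt {s : ℕ} (hs : s ∈ Finset.Ico a (a + n)) : s < T := (Finset.mem_Ico.1 hs).2.trans ha
    rw [← measureReal_biInter_Ico_eq_pow (P := P) (ℱ := ℱ) (B := fun s => {ω | j ∉ S s ω})
      (fun s hs => (measurableSet_mem_of_forall_eq (h.batch_adapted s (hlt hs)) j).compl)
      fun s hs => h.condExp_notMem_batch hk (hlt hs) j]
    exact measureReal_mono fun ω hω => Set.mem_iInter₂.2 hω.2
  · have hkm : (k : ℝ) / m ≤ 1 := div_le_one_of_le₀ (Nat.cast_le.2 hk) (Nat.cast_nonneg m)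
    simp only [ha, false_and, Set.ofPred_false, measureReal_empty]
    exact pow_nonneg (sub_nonneg.2 hkm) n

lemma measureReal_exists_forall_notMem_Ico_le (hk : k ≤ m) (n : ℕ) :
    P.real {ω | ∃ a j, a + n < T ∧ ∀ s ∈ Finset.Ico a (a + n), j ∉ S s ω} ≤
      T * m * (1 - (k : ℝ) / m) ^ n := by
  have hsub : {ω | ∃ a j, a + n < T ∧ ∀ s ∈ Finset.Ico a (a + n), j ∉ S s ω} ⊆
      ⋃ x ∈ Finset.range T ×ˢ (Finset.univ : Finset (Fin m)),
        {ω | x.1 + n < T ∧ ∀ s ∈ Finset.Ico x.1 (x.1 + n), x.2 ∉ S s ω} := by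
    rintro ω ⟨a, j, ha, hj⟩
    refine Set.mem_biUnion (x := (a, j)) ?_ ⟨ha, hj⟩
    simpa using (Nat.le_add_right a n).trans_lt ha
  refine (measureReal_mono hsub (measure_ne_top _ _)).trans
    ((measureReal_biUnion_finset_le _ _).trans ?_)
  refine (Finset.sum_le_card_nsmul _ _ _ fun x _ =>
    h.measureReal_forall_notMem_Ico_le hk x.1 n x.2).trans_eq ?_
  rw [Finset.card_product, Finset.card_range, Finset.card_fin, nsmul_eq_mul, Nat.cast_mul]

end BatchLaw

/-- The sampling noise of LightTouch in iteration `t + 1`, with the errors of the remembered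
values clipped to `[-c, c]`: the clipping makes it a bounded martingale difference sequence, and
has no effect as long as every constraint has recently been refreshed. -/
noncomputable def clippedNoise (h : LightExecution P ℱ W f g dg Gf γ η k T w₁ ξ i S) (c : ℝ)
    (j : Fin m) (t : ℕ) (ω : Ω) : ℝ :=
  samplingNoise γ k (h.state t ω).p
    (fun l => max (-c) (min c (max 0 (g l (h.state t ω).w) - (h.state t ω).μ l))) j (S t ω)

variable (h : LightExecution P ℱ W f g dg Gf γ η k T w₁ ξ i S)

lemma boundedMartingaleDifferences_clippedNoise [IsProbabilityMeasure P] [NeZero m]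
    (hd : ConstraintData W g dg Lg D Gg) (hne : W.Nonempty) (hγ : 0 ≤ γ) (hk0 : 0 < k)
    (hk : k ≤ m) (hc : 0 ≤ c) (hb : γ * m / k * c ≤ b) (j : Fin m) :
    BoundedMartingaleDifferences P ℱ T (2 * b) (h.clippedNoise c j) := by
  set Z : ℕ → Finset (Fin m) → Ω → ℝ := fun t A ω => samplingNoise γ k (h.state t ω).p
    (fun l => max (-c) (min c (max 0 (g l (h.state t ω).w) - (h.state t ω).μ l))) j A
  have hZ : ∀ t < T, ∀ A, Measurable[ℱ t] (Z t A) := fun t ht A => by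
    obtain ⟨hw, hp, hμ⟩ := h.measurable_state hd hne ht.le
    have hg := hd.measurable_comp hw (h.w_mem hd.isClosed t)
    exact Finset.measurable_fun_sum _ fun l _ => (measurable_const.sub (hp l)).mul
      (((measurable_const.max (measurable_const.min ((measurable_const.max (hg l)).sub
        (hμ l)))).const_mul γ).mul_const _)
  have hZb (t : ℕ) (A : Finset (Fin m)) (ω : Ω) : |Z t A ω| ≤ 2 * b :=
    (abs_samplingNoise_le hγ hk0 hk (fun l => (h.p_pos t ω l).le) (h.sum_p t ω)
      (fun l => abs_le.2 ⟨le_max_left _ _, max_le (by linarith) (min_le_left _ _)⟩) j A).trans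
      (by gcongr)
  refine ⟨fun t ht => ?_, fun t _ => ae_of_all _ fun ω => hZb t (S t ω) ω, fun t ht => ?_⟩
  · exact (measurable_select (F := Z t) (h.batch_adapted t ht) fun A =>
      (hZ t ht A).mono (ℱ.mono t.le_succ) le_rfl).stronglyMeasurable
  · refine (h.condExp_comp_batch ht (fun A => (hZ t ht A).stronglyMeasurable) (hZb t)).trans ?_
    refine ae_of_all _ fun ω => ?_
    simp only [Z, sum_powersetCard_samplingNoise hk0 hk, zero_div, Pi.zero_apply]

lemma clippedNoise_eq (hc : ∀ l, |max 0 (g l (h.state t ω).w) - (h.state t ω).μ l| ≤ c)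
    (j : Fin m) : h.clippedNoise c j t ω = samplingNoise γ k (h.state t ω).p
      (fun l => max 0 (g l (h.state t ω).w) - (h.state t ω).μ l) j (S t ω) := by
  unfold clippedNoise
  congr 1
  funext l
  rw [min_eq_right (le_of_abs_le (hc l)), max_eq_right (neg_le_of_abs_le (hc l))]

lemma weights_regret_le [NeZero m] (hd : ConstraintData W g dg Lg D Gg) (hu : u ∈ feasible W g)
    (hγ : 0 ≤ γ) (hη : 0 < η) (hb0 : 0 < b) (hb : γ * m / k * c ≤ b)
    (hc : ∀ t < T, ∀ l, |max 0 (g l (h.state t ω).w) - (h.state t ω).μ l| ≤ c) (j : Fin m) :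
    ∑ t ∈ Finset.range T, γ * (max 0 (g j (h.state t ω).w) -
        ∑ l, (h.state t ω).p l * max 0 (g l (h.state t ω).w)) ≤
      Real.log m / η + 2 * η * T * (γ * (Lg * D) + b) ^ 2 +
        ∑ t ∈ Finset.range T, h.clippedNoise c j t ω := by
  set x : ℕ → Fin m → ℝ := fun t =>
    supergradient γ k (S t ω) (fun l => g l (h.state t ω).w) (h.state t ω).μ
  have hLD : 0 ≤ Lg * D := (h.μ_mem_Icc hd hu 0 ω j).1.trans (h.μ_mem_Icc hd hu 0 ω j).2
  have hregret := sum_sub_sum_mul_le (T := T) (B := γ * (Lg * D) + b)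
    (p := fun t => (h.state t ω).p) (x := x) hη (by positivity) (h.p_pos 0 ω) (h.sum_p 0 ω)
    (fun t => by rw [h.state_succ]) (fun t ht l =>
      (abs_supergradient_le hγ k (S t ω) (h.μ_mem_Icc hd hu t ω l).1 (h.μ_mem_Icc hd hu t ω l).2
        (hc t ht l)).trans (by gcongr)) j
  have hdecomp : ∑ t ∈ Finset.range T, γ * (max 0 (g j (h.state t ω).w) -
        ∑ l, (h.state t ω).p l * max 0 (g l (h.state t ω).w)) =
      ∑ t ∈ Finset.range T, (x t j - ∑ l, (h.state t ω).p l * x t l) +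
        ∑ t ∈ Finset.range T, h.clippedNoise c j t ω := by
    rw [← Finset.sum_add_distrib]
    refine Finset.sum_congr rfl fun t ht => ?_
    rw [h.clippedNoise_eq (hc t (Finset.mem_range.1 ht)) j]
    exact mul_max_zero_sub_sum_eq γ k (S t ω) (fun l => g l (h.state t ω).w) (h.state t ω).μ _ j
  have hlog : -Real.log ((h.state 0 ω).p j) = Real.log m := by
    rw [h.state_zero, one_div, Real.log_inv, neg_neg]
  rw [hdecomp, ← hlog]
  gcongr

lemma measureReal_weights_regret_gt_le [IsProbabilityMeasure P] [NeZero m]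
    (hd : ConstraintData W g dg Lg D Gg) (hu : u ∈ feasible W g) (hγ : 0 ≤ γ) (hη : 0 < η)
    (hG : 0 ≤ Gf + γ * Gg) (hT : 0 < T) (hk0 : 0 < k) (hk : k ≤ m) (hb0 : 0 < b)
    (hb : γ * m / k * (n * (Lg * (η * (Gf + γ * Gg)))) ≤ b) (hL : 0 ≤ L) :
    P.real {ω | ∃ j, Real.log m / η + 2 * η * T * (γ * (Lg * D) + b) ^ 2 +
        2 * b * √(2 * T * L) < ∑ t ∈ Finset.range T, γ * (max 0 (g j (h.state t ω).w) -
          ∑ l, (h.state t ω).p l * max 0 (g l (h.state t ω).w))} ≤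
      m * Real.exp (-L) + T * m * (1 - (k : ℝ) / m) ^ n := by
  set c : ℝ := n * (Lg * (η * (Gf + γ * Gg)))
  have hnoise (j : Fin m) := (h.boundedMartingaleDifferences_clippedNoise (P := P) (c := c) hd
    ⟨u, hu.1⟩ hγ hk0 hk (by positivity) hb j).measureReal_sum_ge_le hT (by positivity) hL
  have hunion : P.real ((⋃ j, {ω | 2 * b * √(2 * T * L) ≤
        ∑ t ∈ Finset.range T, h.clippedNoise c j t ω}) ∪
      {ω | ∃ a j, a + n < T ∧ ∀ s ∈ Finset.Ico a (a + n), j ∉ S s ω}) ≤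
      m * Real.exp (-L) + T * m * (1 - (k : ℝ) / m) ^ n := by
    refine (measureReal_union_le _ _).trans
      (add_le_add ?_ (h.measureReal_exists_forall_notMem_Ico_le hk n))
    refine (measureReal_iUnion_fintype_le _).trans
      ((Finset.sum_le_card_nsmul _ _ _ fun j _ => hnoise j).trans_eq ?_)
    rw [Finset.card_fin, nsmul_eq_mul]
  have hξ : ∀ᵐ ω ∂P, ∀ t < T, ‖ξ t ω‖ ≤ Gf :=
    ae_all_iff.2 fun t => ae_all_iff.2 (h.subgradients.bounded t)
  refine (ENNReal.toReal_mono (measure_ne_top _ _) (measure_mono_ae ?_)).trans hunion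
  filter_upwards [hξ] with ω hω
  rintro ⟨j, hj⟩
  by_contra hgood
  obtain ⟨hsmall, hfresh⟩ := not_or.1 hgood
  have hc : ∀ t < T, ∀ l, |max 0 (g l (h.state t ω).w) - (h.state t ω).μ l| ≤ c :=
    fun t ht l => h.abs_max_zero_sub_μ_le hd hγ hη.le hω ht l fun hnt => by
      by_contra! hmissed
      refine hfresh ⟨t - n, l, by omega, ?_⟩
      rwa [Nat.sub_add_cancel hnt.le]
  have hregret := h.weights_regret_le hd hu hγ hη hb0 hb hc j
  have hnoise_lt : ∑ t ∈ Finset.range T, h.clippedNoise c j t ω < 2 * b * √(2 * T * L) :=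
    lt_of_not_ge fun hle => hsmall (Set.mem_iUnion.2 ⟨j, hle⟩)
  linarith

end LightExecution

/-! ### Choice of the parameters -/

section RegretErrors

variable {a e s D A G β b L M η : ℝ}

lemma sqrt_two_mul_sq_mul_le {y : ℝ} (hs : 0 ≤ s) (hy : 0 ≤ y) (hL : L ≤ 2 * y ^ 2) :
    √(2 * s ^ 2 * L) ≤ 2 * (y * s) := by
  refine Real.sqrt_le_iff.2 ⟨by positivity, ?_⟩
  calc 2 * s ^ 2 * L ≤ 2 * s ^ 2 * (2 * y ^ 2) := by gcongr
    _ = (2 * (y * s)) ^ 2 := by ring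

lemma descent_error_le (ha : 1 ≤ a) (he : 1 ≤ e) (hs : 0 < s) (hD : 0 < D) (hA : 0 < A)
    (hG : 0 ≤ G) (hGA : G ≤ A) (hη : η = a * D / (A * s)) (hL : L ≤ 2 * e ^ 2) :
    D ^ 2 / (2 * η) + η * s ^ 2 * G ^ 2 / 2 + 2 * (G * D) * √(2 * s ^ 2 * L) ≤
      5 * (D * A * a * e * s) := by
  have ha0 : 0 < a := one_pos.trans_le ha
  have hdist : D ^ 2 / (2 * η) ≤ D * A * a * e * s / 2 :=
    calc D ^ 2 / (2 * η) = D * A * s / 2 * (1 / a) := by rw [hη]; field_simp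
      _ ≤ D * A * s / 2 * (a * e) := by
        gcongr
        exact ((div_le_one ha0).2 ha).trans (one_le_mul_of_one_le_of_one_le ha he)
      _ = D * A * a * e * s / 2 := by ring
  have hstep : η * s ^ 2 * G ^ 2 / 2 ≤ D * A * a * e * s / 2 :=
    calc η * s ^ 2 * G ^ 2 / 2 ≤ η * s ^ 2 * A ^ 2 / 2 := by
          have : 0 ≤ η := by rw [hη]; positivity
          gcongr
      _ = D * A * a * 1 * s / 2 := by rw [hη]; field_simp
      _ ≤ D * A * a * e * s / 2 := by gcongr
  have hnoise : 2 * (G * D) * √(2 * s ^ 2 * L) ≤ 4 * (D * A * a * e * s) :=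
    calc 2 * (G * D) * √(2 * s ^ 2 * L) ≤ 2 * (A * D) * (2 * (e * s)) := by
          gcongr
          exact sqrt_two_mul_sq_mul_le hs.le (by positivity) hL
      _ = 4 * (D * A * 1 * e * s) := by ring
      _ ≤ 4 * (D * A * a * e * s) := by gcongr
  linarith

lemma weights_error_le (ha : 1 ≤ a) (he : 1 ≤ e) (hs : 0 < s) (hD : 1 ≤ D) (hA : 0 < A)
    (hβ : 0 ≤ β) (hβA : β ≤ A) (hη : η = a * D / (A * s)) (hM : M ≤ a ^ 2)
    (hL : L ≤ 2 * (a * e) ^ 2) :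
    M / η + 2 * η * s ^ 2 * (β + 4 * A) ^ 2 + 2 * (4 * A) * √(2 * s ^ 2 * L) ≤
      67 * (D * A * a * e * s) := by
  have hη0 : 0 < η := by rw [hη]; positivity
  have hentropy : M / η ≤ D * A * a * e * s :=
    calc M / η ≤ a ^ 2 / η := by gcongr
      _ = 1 / D * A * a * 1 * s := by rw [hη]; field_simp
      _ ≤ D * A * a * e * s := by
        gcongr
        exact (div_le_one (by positivity)).2 hD |>.trans hD
  have hstep : 2 * η * s ^ 2 * (β + 4 * A) ^ 2 ≤ 50 * (D * A * a * e * s) :=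
    calc 2 * η * s ^ 2 * (β + 4 * A) ^ 2 ≤ 2 * η * s ^ 2 * (A + 4 * A) ^ 2 := by gcongr
      _ = 50 * (D * A * a * 1 * s) := by rw [hη]; field_simp; ring
      _ ≤ 50 * (D * A * a * e * s) := by gcongr
  have hnoise : 2 * (4 * A) * √(2 * s ^ 2 * L) ≤ 16 * (D * A * a * e * s) :=
    calc 2 * (4 * A) * √(2 * s ^ 2 * L) ≤ 2 * (4 * A) * (2 * (a * e * s)) := by
          gcongr
          exact sqrt_two_mul_sq_mul_le hs.le (by positivity) hL
      _ = 16 * (1 * A * a * e * s) := by ring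
      _ ≤ 16 * (D * A * a * e * s) := by gcongr
  linarith

end RegretErrors

section FailureProbability

variable {m T k n : ℕ} {x y δ Λ : ℝ}

lemma one_le_one_add_log_natCast (n : ℕ) : 1 ≤ 1 + Real.log n :=
  le_add_of_nonneg_right (Real.log_natCast_nonneg n)

lemma one_le_one_add_log_one_div (hδ : 0 < δ) (hδ1 : δ < 1) : 1 ≤ 1 + Real.log (1 / δ) :=
  le_add_of_nonneg_right (Real.log_nonneg (one_le_one_div hδ hδ1.le))

lemma one_add_log_mul_le (hx : 1 ≤ x) (hy : 1 ≤ y) :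
    1 + Real.log (x * y) ≤ (1 + Real.log x) * (1 + Real.log y) := by
  rw [Real.log_mul (by positivity) (by positivity)]
  linarith [mul_nonneg (Real.log_nonneg hx) (Real.log_nonneg hy)]

lemma log_three_mul_div_le (hx : 1 ≤ x) (hδ : 0 < δ) (hδ1 : δ < 1) :
    Real.log (3 * x / δ) ≤ 2 * ((1 + Real.log x) * (1 + Real.log (1 / δ))) := by
  have hlog3 : Real.log 3 ≤ 2 := by linarith [Real.log_le_sub_one_of_pos (x := 3) three_pos]
  have hδ' : 1 ≤ 1 / δ := one_le_one_div hδ hδ1.le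
  have hmul := one_add_log_mul_le hx hδ'
  have hlog : 0 ≤ Real.log (x * (1 / δ)) := Real.log_nonneg (one_le_mul_of_one_le_of_one_le hx hδ')
  rw [show 3 * x / δ = 3 * (x * (1 / δ)) by ring, Real.log_mul (by positivity) (by positivity)]
  linarith

lemma one_le_log_three_mul_div (hx : 1 ≤ x) (hδ : 0 < δ) (hδ1 : δ < 1) :
    1 ≤ Real.log (3 * x / δ) := by
  rw [Real.le_log_iff_exp_le (by positivity), le_div_iff₀ hδ]
  calc Real.exp 1 * δ ≤ 3 * 1 := by gcongr; exact Real.exp_one_lt_three.le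
    _ ≤ 3 * x := by gcongr

lemma mul_exp_neg_log_three_mul_div (hx : 0 < x) (hδ : 0 < δ) :
    x * Real.exp (-Real.log (3 * x / δ)) = δ / 3 := by
  rw [Real.exp_neg, Real.exp_log (by positivity)]
  field_simp

lemma one_sub_div_pow_le_exp_neg (hk0 : 0 < k) (hk : k ≤ m) (hn : (m : ℝ) / k * Λ ≤ n) :
    (1 - (k : ℝ) / m) ^ n ≤ Real.exp (-Λ) := by
  have : (0 : ℝ) < k := Nat.cast_pos.2 hk0
  have hm : (0 : ℝ) < m := Nat.cast_pos.2 (hk0.trans_le hk)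
  have hr : 0 ≤ 1 - (k : ℝ) / m := sub_nonneg.2 ((div_le_one hm).2 (Nat.cast_le.2 hk))
  have hΛ : Λ ≤ n * ((k : ℝ) / m) := by
    calc Λ = (m : ℝ) / k * Λ * ((k : ℝ) / m) := by field_simp
      _ ≤ _ := by gcongr
  calc (1 - (k : ℝ) / m) ^ n ≤ Real.exp (-((k : ℝ) / m)) ^ n :=
        pow_le_pow_left₀ hr (Real.one_sub_le_exp_neg _) n
    _ ≤ Real.exp (-Λ) := by
        rw [← Real.exp_nat_mul]
        gcongr
        linarith

lemma failure_probability_le (hT : 0 < T) (hδ : 0 < δ) (hk0 : 0 < k) (hk : k ≤ m)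
    (hn : (m : ℝ) / k * Real.log (3 * (m * T) / δ) ≤ n) :
    Real.exp (-Real.log (3 / δ)) + (m * Real.exp (-Real.log (3 * m / δ)) +
      T * m * (1 - (k : ℝ) / m) ^ n) ≤ δ := by
  have hm : (0 : ℝ) < m := Nat.cast_pos.2 (hk0.trans_le hk)
  have : (0 : ℝ) < T := Nat.cast_pos.2 hT
  have hdescent := mul_exp_neg_log_three_mul_div (x := 1) one_pos hδ
  have hweights := mul_exp_neg_log_three_mul_div (x := m) hm hδ
  have hmissed : T * m * (1 - (k : ℝ) / m) ^ n ≤ δ / 3 := by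
    rw [← mul_exp_neg_log_three_mul_div (x := m * T) (by positivity) hδ, mul_comm (T : ℝ)]
    gcongr
    exact one_sub_div_pow_le_exp_neg hk0 hk hn
  rw [one_mul, mul_one] at hdescent
  linarith

end FailureProbability

section Iterations

variable {m T : ℕ} {a c D A δ ε : ℝ}

/-- The main term `(1 + ln m) D² A² (1 + ln (1/δ)) / ε²` of the iteration count. -/
noncomputable def iterationTerm (m : ℕ) (D A δ ε : ℝ) : ℝ :=
  (1 + Real.log m) * D ^ 2 * A ^ 2 * (1 + Real.log (1 / δ)) / ε ^ 2

lemma iterations_eq_ceil : iterations c m D A δ ε = ⌈c * iterationTerm m D A δ ε⌉₊ := rfl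

lemma iterationTerm_pos (hD : 0 < D) (hA : 0 < A) (hε : 0 < ε) (hδ : 0 < δ) (hδ1 : δ < 1) :
    0 < iterationTerm m D A δ ε := by
  have := one_le_one_add_log_natCast m
  have := one_le_one_add_log_one_div hδ hδ1
  unfold iterationTerm
  positivity

lemma one_le_iterationTerm (hε : 0 < ε) (hδ : 0 < δ) (hδ1 : δ < 1) (hεDA : ε ≤ D * A) :
    1 ≤ iterationTerm m D A δ ε := by
  rw [iterationTerm, one_le_div (by positivity)]
  calc ε ^ 2 ≤ (D * A) ^ 2 := by gcongr
    _ = 1 * D ^ 2 * A ^ 2 * 1 := by ring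
    _ ≤ (1 + Real.log m) * D ^ 2 * A ^ 2 * (1 + Real.log (1 / δ)) := by
      have := one_le_one_add_log_natCast m
      have := one_le_one_add_log_one_div hδ hδ1
      gcongr

lemma iterations_pos (hc : 0 < c) (hD : 0 < D) (hA : 0 < A) (hε : 0 < ε) (hδ : 0 < δ)
    (hδ1 : δ < 1) : 0 < iterations c m D A δ ε :=
  Nat.ceil_pos.2 (mul_pos hc (iterationTerm_pos hD hA hε hδ hδ1))

lemma iterations_le (hc : 0 ≤ c) (hε : 0 < ε) (hδ : 0 < δ) (hδ1 : δ < 1) (hεDA : ε ≤ D * A) :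
    (iterations c m D A δ ε : ℝ) ≤ (c + 1) * iterationTerm m D A δ ε := by
  have hone := one_le_iterationTerm (m := m) hε hδ hδ1 hεDA
  have hceil := Nat.ceil_lt_add_one (mul_nonneg hc (zero_le_one.trans hone))
  rw [iterations_eq_ceil]
  linarith

lemma mul_sqrt_iterations_le (hε : 0 < ε) (hδ : 0 < δ) (hδ1 : δ < 1)
    (hT : T = iterations (a ^ 2) m D A δ ε) :
    a * (D * A * √(1 + Real.log m) * √(1 + Real.log (1 / δ)) * √T) ≤ ε * T := by
  have := one_le_one_add_log_natCast m
  have := one_le_one_add_log_one_div hδ hδ1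
  have hsq : (a * (D * A * √(1 + Real.log m) * √(1 + Real.log (1 / δ)))) ^ 2 =
      ε ^ 2 * (a ^ 2 * iterationTerm m D A δ ε) := by
    simp only [mul_pow, iterationTerm]
    rw [Real.sq_sqrt (by positivity), Real.sq_sqrt (by positivity)]
    field_simp
  have hle : a * (D * A * √(1 + Real.log m) * √(1 + Real.log (1 / δ))) ≤ ε * √T := by
    refine le_of_abs_le (abs_le_of_sq_le_sq ?_ (by positivity))
    rw [hsq, mul_pow, Real.sq_sqrt (Nat.cast_nonneg _), hT, iterations_eq_ceil]
    gcongr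
    exact Nat.le_ceil _
  calc _ = a * (D * A * √(1 + Real.log m) * √(1 + Real.log (1 / δ))) * √T := by ring
    _ ≤ ε * √T * √T := by gcongr
    _ = ε * T := by rw [mul_assoc, Real.mul_self_sqrt (Nat.cast_nonneg T)]

end Iterations

section Minibatches

variable {m T : ℕ} {A D G Lg δ η γ : ℝ}

lemma minibatchSize_pos [NeZero m] (hT : 0 < T) (hδ : 0 < δ) (hδ1 : δ < 1) :
    0 < minibatchSize m δ T := by
  have := one_le_one_add_log_natCast m
  have := one_le_one_add_log_one_div hδ hδ1
  have := one_le_one_add_log_natCast T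
  have : 0 < m := NeZero.pos m
  exact Nat.ceil_pos.2 (by positivity)

lemma sq_rpow_quarter {x : ℝ} (hx : 0 ≤ x) : (x ^ (1 / 4 : ℝ)) ^ 2 = √x := by
  rw [← Real.rpow_natCast, ← Real.rpow_mul hx, Real.sqrt_eq_rpow]; norm_num

lemma sq_rpow_three_quarters {x : ℝ} (hx : 0 ≤ x) : (x ^ (3 / 4 : ℝ)) ^ 2 = √x ^ 3 := by
  rw [← Real.rpow_natCast, ← Real.rpow_mul hx, Real.sqrt_eq_rpow, ← Real.rpow_natCast,
    ← Real.rpow_mul hx]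
  norm_num

lemma sq_div_minibatchSize_mul_le [NeZero m] (hT : 0 < T) (hδ : 0 < δ) (hδ1 : δ < 1) :
    ((m : ℝ) / minibatchSize m δ T) ^ 2 *
      (√(1 + Real.log m) ^ 3 * (1 + Real.log (1 / δ)) * (1 + Real.log T)) ≤ √T := by
  have := one_le_one_add_log_natCast m
  have := one_le_one_add_log_one_div hδ hδ1
  have := one_le_one_add_log_natCast T
  have := minibatchSize_pos (m := m) hT hδ hδ1
  have hle := Nat.le_ceil ((m : ℝ) * (1 + Real.log m) ^ (3 / 4 : ℝ) * √(1 + Real.log (1 / δ)) *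
    √(1 + Real.log T) / (T : ℝ) ^ (1 / 4 : ℝ))
  change _ ≤ (minibatchSize m δ T : ℝ) at hle
  rw [div_le_iff₀ (by positivity)] at hle
  have hsq := pow_le_pow_left₀ (by positivity) hle 2
  rw [mul_pow, mul_pow, mul_pow, mul_pow, sq_rpow_quarter (Nat.cast_nonneg T),
    sq_rpow_three_quarters (by positivity), Real.sq_sqrt (by positivity),
    Real.sq_sqrt (by positivity)] at hsq
  rw [div_pow, div_mul_eq_mul_div, div_le_iff₀ (by positivity)]
  linarith

/-- The ceiling is the number of iterations within which, with high probability, every entry of `μ`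
is refreshed. -/
lemma div_minibatchSize_mul_ceil_le [NeZero m] (hT : 0 < T) (hδ : 0 < δ) (hδ1 : δ < 1)
    (hk : minibatchSize m δ T ≤ m) :
    (m : ℝ) / minibatchSize m δ T *
      ⌈(m : ℝ) / minibatchSize m δ T * Real.log (3 * (m * T) / δ)⌉₊ * √(1 + Real.log m) ≤
      4 * √T := by
  have hm : (1 : ℝ) ≤ m := Nat.one_le_cast.2 (NeZero.pos m)
  have hT1 : (1 : ℝ) ≤ T := Nat.one_le_cast.2 hT
  have hk0 : (0 : ℝ) < minibatchSize m δ T := Nat.cast_pos.2 (minibatchSize_pos hT hδ hδ1)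
  have hr : 1 ≤ (m : ℝ) / minibatchSize m δ T := (one_le_div hk0).2 (Nat.cast_le.2 hk)
  have hmT : 1 ≤ (m : ℝ) * T := one_le_mul_of_one_le_of_one_le hm hT1
  have hΛ1 := one_le_log_three_mul_div hmT hδ hδ1
  have := one_le_one_add_log_natCast m
  have := one_le_one_add_log_one_div hδ hδ1
  have hΛ : Real.log (3 * (m * T) / δ) ≤
      2 * ((1 + Real.log m) * (1 + Real.log T) * (1 + Real.log (1 / δ))) := by
    refine (log_three_mul_div_le hmT hδ hδ1).trans ?_
    gcongr
    exact one_add_log_mul_le hm hT1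
  have hbatch := sq_div_minibatchSize_mul_le (m := m) hT hδ hδ1
  set r := (m : ℝ) / minibatchSize m δ T
  have hceil : (⌈r * Real.log (3 * (m * T) / δ)⌉₊ : ℝ) ≤ 2 * (r * Real.log (3 * (m * T) / δ)) :=
    Nat.ceil_le_two_mul (by linarith [one_le_mul_of_one_le_of_one_le hr hΛ1])
  calc r * ⌈r * Real.log (3 * (m * T) / δ)⌉₊ * √(1 + Real.log m)
      ≤ r * (2 * (r * (2 * (√(1 + Real.log m) ^ 2 * (1 + Real.log T) *
          (1 + Real.log (1 / δ)))))) * √(1 + Real.log m) := by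
        rw [Real.sq_sqrt (by positivity)]
        gcongr
        exact hceil.trans (by gcongr)
    _ = 4 * (r ^ 2 * (√(1 + Real.log m) ^ 3 * (1 + Real.log (1 / δ)) * (1 + Real.log T))) := by
        ring
    _ ≤ 4 * √T := by gcongr

lemma staleness_le [NeZero m] (hT : 0 < T) (hδ : 0 < δ) (hδ1 : δ < 1)
    (hk : minibatchSize m δ T ≤ m) (hA : 0 < A) (hG : 0 ≤ G) (hGA : G ≤ A)
    (hβA : γ * (Lg * D) ≤ A) (hη : η = √(1 + Real.log m) * D / (A * √T)) :
    γ * m / minibatchSize m δ T *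
      (⌈(m : ℝ) / minibatchSize m δ T * Real.log (3 * (m * T) / δ)⌉₊ * (Lg * (η * G))) ≤
      4 * A := by
  have : 0 < √(T : ℝ) := Real.sqrt_pos.2 (Nat.cast_pos.2 hT)
  have hrefresh := div_minibatchSize_mul_ceil_le (m := m) hT hδ hδ1 hk
  set r := (m : ℝ) / minibatchSize m δ T with hr
  set n := (⌈r * Real.log (3 * (m * T) / δ)⌉₊ : ℝ)
  calc γ * m / minibatchSize m δ T * (n * (Lg * (η * G)))
      = γ * (Lg * D) * (r * n * √(1 + Real.log m)) * (G / A) / √T := by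
        rw [hη, hr]; field_simp
    _ ≤ A * (4 * √T) * 1 / √T := by
        have hmul := mul_le_mul hβA hrefresh (by positivity) hA.le
        gcongr ?_ / _
        exact mul_le_mul hmul ((div_le_one hA).2 hGA) (by positivity) (by positivity)
    _ = 4 * A := by field_simp

end Minibatches

section Checks

variable {m T : ℕ} {c D A δ ε : ℝ}

/-- The second term of `checksBound`, which accounts for the minibatches. -/
noncomputable def minibatchTerm (m : ℕ) (D A δ ε : ℝ) (T : ℕ) : ℝ :=
  (m : ℝ) * (1 + Real.log m) ^ (3 / 2 : ℝ) * D ^ (3 / 2 : ℝ) * A ^ (3 / 2 : ℝ) *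
    (1 + Real.log (1 / δ)) ^ (5 / 4 : ℝ) / ε ^ (3 / 2 : ℝ) * √(1 + Real.log T)

lemma checksBound_eq_add :
    checksBound m D A δ ε T = iterationTerm m D A δ ε + minibatchTerm m D A δ ε T := rfl

lemma minibatchTerm_eq (hD : 0 < D) (hA : 0 < A) (hε : 0 < ε) (hδ : 0 < δ) (hδ1 : δ < 1) :
    minibatchTerm m D A δ ε T = m * (iterationTerm m D A δ ε ^ (3 / 4 : ℝ) *
      ((1 + Real.log m) ^ (3 / 4 : ℝ) * √(1 + Real.log (1 / δ)))) * √(1 + Real.log T) := by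
  have hx := zero_lt_one.trans_le (one_le_one_add_log_natCast m)
  have hy := zero_lt_one.trans_le (one_le_one_add_log_one_div hδ hδ1)
  have hsq : ∀ t : ℝ, 0 < t → (t ^ 2) ^ (3 / 4 : ℝ) = t ^ (3 / 2 : ℝ) := fun t ht => by
    rw [← Real.rpow_natCast, ← Real.rpow_mul ht.le]; norm_num
  rw [minibatchTerm, iterationTerm]
  set x := 1 + Real.log m
  set y := 1 + Real.log (1 / δ)
  have hx2 : x ^ (3 / 2 : ℝ) = x ^ (3 / 4 : ℝ) * x ^ (3 / 4 : ℝ) := by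
    rw [← Real.rpow_add hx]; norm_num
  have hy2 : y ^ (5 / 4 : ℝ) = y ^ (3 / 4 : ℝ) * √y := by
    rw [Real.sqrt_eq_rpow, ← Real.rpow_add hy]; norm_num
  rw [Real.div_rpow (by positivity) (by positivity), Real.mul_rpow (by positivity) hy.le,
    Real.mul_rpow (by positivity) (by positivity), Real.mul_rpow hx.le (by positivity),
    hsq D hD, hsq A hA, hsq ε hε, hx2, hy2]
  ring

lemma le_minibatchTerm (hD : 0 < D) (hA : 0 < A) (hε : 0 < ε) (hδ : 0 < δ) (hδ1 : δ < 1)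
    (hεDA : ε ≤ D * A) : (m : ℝ) ≤ minibatchTerm m D A δ ε T := by
  have hM := one_le_iterationTerm (m := m) hε hδ hδ1 hεDA
  rw [minibatchTerm_eq hD hA hε hδ hδ1, mul_assoc]
  refine le_mul_of_one_le_right (Nat.cast_nonneg m) ?_
  refine one_le_mul_of_one_le_of_one_le (one_le_mul_of_one_le_of_one_le ?_
    (one_le_mul_of_one_le_of_one_le ?_ ?_)) ?_
  · exact Real.one_le_rpow hM (by norm_num)
  · exact Real.one_le_rpow (one_le_one_add_log_natCast m) (by norm_num)
  · exact Real.one_le_sqrt.2 (one_le_one_add_log_one_div hδ hδ1)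
  · exact Real.one_le_sqrt.2 (one_le_one_add_log_natCast T)

lemma iterations_rpow_le (hc : 0 ≤ c) (hε : 0 < ε) (hδ : 0 < δ) (hδ1 : δ < 1)
    (hεDA : ε ≤ D * A) :
    (iterations c m D A δ ε : ℝ) ^ (3 / 4 : ℝ) ≤
      (c + 1) * iterationTerm m D A δ ε ^ (3 / 4 : ℝ) := by
  have hM := one_le_iterationTerm (m := m) hε hδ hδ1 hεDA
  calc (iterations c m D A δ ε : ℝ) ^ (3 / 4 : ℝ)
      ≤ ((c + 1) * iterationTerm m D A δ ε) ^ (3 / 4 : ℝ) := by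
        gcongr
        exact iterations_le hc hε hδ hδ1 hεDA
    _ = (c + 1) ^ (3 / 4 : ℝ) * iterationTerm m D A δ ε ^ (3 / 4 : ℝ) :=
        Real.mul_rpow (by positivity) (by positivity)
    _ ≤ (c + 1) * iterationTerm m D A δ ε ^ (3 / 4 : ℝ) := by
        gcongr
        exact Real.rpow_le_self_of_one_le (by linarith) (by norm_num)

lemma mul_minibatchSize_sub_one_le (hc : 0 < c) (hD : 0 < D) (hA : 0 < A) (hε : 0 < ε)
    (hδ : 0 < δ) (hδ1 : δ < 1) (hεDA : ε ≤ D * A) (hT : T = iterations c m D A δ ε) :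
    (T : ℝ) * (minibatchSize m δ T - 1) ≤ (c + 1) * minibatchTerm m D A δ ε T := by
  have := one_le_one_add_log_natCast m
  have := one_le_one_add_log_one_div hδ hδ1
  have := one_le_one_add_log_natCast T
  have hT0 : (0 : ℝ) < T := Nat.cast_pos.2 (hT ▸ iterations_pos hc hD hA hε hδ hδ1)
  have hpow : (T : ℝ) / (T : ℝ) ^ (1 / 4 : ℝ) = (T : ℝ) ^ (3 / 4 : ℝ) := by
    rw [div_eq_iff (by positivity), ← Real.rpow_add hT0]; norm_num
  have hTpow := iterations_rpow_le (m := m) hc.le hε hδ hδ1 hεDA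
  rw [← hT] at hTpow
  have hceil : (minibatchSize m δ T : ℝ) - 1 ≤ m * (1 + Real.log m) ^ (3 / 4 : ℝ) *
      √(1 + Real.log (1 / δ)) * √(1 + Real.log T) / (T : ℝ) ^ (1 / 4 : ℝ) :=
    sub_le_iff_le_add.2 (Nat.ceil_lt_add_one (by positivity)).le
  calc (T : ℝ) * (minibatchSize m δ T - 1)
      ≤ T * (m * (1 + Real.log m) ^ (3 / 4 : ℝ) * √(1 + Real.log (1 / δ)) *
          √(1 + Real.log T) / (T : ℝ) ^ (1 / 4 : ℝ)) := by gcongr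
    _ = T / (T : ℝ) ^ (1 / 4 : ℝ) * (m * ((1 + Real.log m) ^ (3 / 4 : ℝ) *
          √(1 + Real.log (1 / δ))) * √(1 + Real.log T)) := by ring
    _ ≤ (c + 1) * iterationTerm m D A δ ε ^ (3 / 4 : ℝ) * (m * ((1 + Real.log m) ^ (3 / 4 : ℝ) *
          √(1 + Real.log (1 / δ))) * √(1 + Real.log T)) := by
        rw [hpow]
        gcongr
    _ = (c + 1) * minibatchTerm m D A δ ε T := by
        rw [minibatchTerm_eq hD hA hε hδ hδ1]; ring

lemma light_checks_le (hc : 0 < c) (hD : 0 < D) (hA : 0 < A) (hε : 0 < ε) (hδ : 0 < δ)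
    (hδ1 : δ < 1) (hεDA : ε ≤ D * A) (hT : T = iterations c m D A δ ε) :
    (m : ℝ) + T * (1 + minibatchSize m δ T) ≤ 2 * (c + 1) * checksBound m D A δ ε T := by
  have hm := le_minibatchTerm (m := m) (T := T) hD hA hε hδ hδ1 hεDA
  have hTle := iterations_le (m := m) hc.le hε hδ hδ1 hεDA
  rw [← hT] at hTle
  have hk := mul_minibatchSize_sub_one_le hc hD hA hε hδ hδ1 hεDA hT
  have := mul_nonneg hc.le ((Nat.cast_nonneg m).trans hm)
  rw [checksBound_eq_add]
  linarith

lemma full_checks_le (hc : 0 < c) (hD : 0 < D) (hA : 0 < A) (hε : 0 < ε) (hδ : 0 < δ)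
    (hδ1 : δ < 1) (hεDA : ε ≤ D * A) (hT : T = iterations c m D A δ ε)
    (hk : m < minibatchSize m δ T) :
    (T : ℝ) * (m + 1) ≤ 2 * (c + 1) * checksBound m D A δ ε T := by
  have hTle := iterations_le (m := m) hc.le hε hδ hδ1 hεDA
  rw [← hT] at hTle
  have hm : (m : ℝ) ≤ minibatchSize m δ T - 1 := by
    rw [le_sub_iff_add_le]
    exact_mod_cast hk
  have hTm : (T : ℝ) * m ≤ (c + 1) * minibatchTerm m D A δ ε T :=
    (mul_le_mul_of_nonneg_left hm (Nat.cast_nonneg T)).trans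
      (mul_minibatchSize_sub_one_le hc hD hA hε hδ hδ1 hεDA hT)
  have := (Nat.cast_nonneg (α := ℝ) T).trans hTle
  have := (mul_nonneg (Nat.cast_nonneg T) (Nat.cast_nonneg m)).trans hTm
  rw [checksBound_eq_add]
  linarith

end Checks

section Conclusion

variable {Ω : Type*} {mΩ : MeasurableSpace Ω} {P : Measure Ω}
  {ℱ : Filtration ℕ mΩ} {d m : ℕ} {W : Set (E d)} {f : E d → ℝ} {g : Fin m → E d → ℝ}
  {dg : Fin m → E d → E d} {Lg : ℝ≥0} {A D G Gf Gg β γ δ ε η : ℝ} {T : ℕ} {w₁ : Ω → E d}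
  {ξ : ℕ → Ω → E d} {i : ℕ → Ω → Fin m} {S : ℕ → Ω → Finset (Fin m)} {u : E d}

lemma one_sub_le_measureReal [IsProbabilityMeasure P] {s bad : Set Ω} (h : badᶜ ⊆ s)
    (hbad : P.real bad ≤ δ) :
    1 - δ ≤ P.real s := by
  have hunion : bad ∪ s = Set.univ :=
    Set.univ_subset_iff.1 (Set.union_compl_self bad ▸ Set.union_subset_union_right bad h)
  have hle := measureReal_union_le (μ := P) bad s
  rw [hunion, probReal_univ] at hle
  linarith

lemma light_errors_le [NeZero m] (hε : 0 < ε) (hδ : 0 < δ) (hδ1 : δ < 1) (hD : 1 ≤ D)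
    (hA : 0 < A) (hG : 0 ≤ G) (hGA : G ≤ A) (hβ : 0 ≤ β) (hβA : β ≤ A) (hT0 : 0 < T)
    (hT : T = iterations (72 ^ 2) m D A δ ε) (hη : η = √(1 + Real.log m) * D / (A * √T)) :
    D ^ 2 / (2 * η) + η * T * G ^ 2 / 2 + 2 * (G * D) * √(2 * T * Real.log (3 / δ)) +
      (Real.log m / η + 2 * η * T * (β + 4 * A) ^ 2 +
        2 * (4 * A) * √(2 * T * Real.log (3 * m / δ))) ≤ ε * T := by
  have hx := one_le_one_add_log_natCast m
  have hy := one_le_one_add_log_one_div hδ hδ1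
  have hx2 := Real.sq_sqrt (zero_le_one.trans hx)
  have hy2 := Real.sq_sqrt (zero_le_one.trans hy)
  have hs : 0 < √(T : ℝ) := Real.sqrt_pos.2 (Nat.cast_pos.2 hT0)
  have hLdescent : Real.log (3 / δ) ≤ 2 * √(1 + Real.log (1 / δ)) ^ 2 := by
    simpa only [mul_one, Real.log_one, add_zero, one_mul, hy2]
      using log_three_mul_div_le le_rfl hδ hδ1
  have hLweights : Real.log (3 * m / δ) ≤
      2 * (√(1 + Real.log m) * √(1 + Real.log (1 / δ))) ^ 2 := by
    rw [mul_pow, hx2, hy2]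
    exact log_three_mul_div_le (Nat.one_le_cast.2 (NeZero.pos m)) hδ hδ1
  have hdescent := descent_error_le (Real.one_le_sqrt.2 hx) (Real.one_le_sqrt.2 hy) hs
    (one_pos.trans_le hD) hA hG hGA hη hLdescent
  have hweights := weights_error_le (Real.one_le_sqrt.2 hx) (Real.one_le_sqrt.2 hy) hs hD hA hβ hβA
    hη (M := Real.log m) (by rw [hx2]; linarith) hLweights
  rw [Real.sq_sqrt (Nat.cast_nonneg T)] at hdescent hweights
  linarith [mul_sqrt_iterations_le hε hδ hδ1 hT]

lemma full_errors_le (hε : 0 < ε) (hδ : 0 < δ) (hδ1 : δ < 1) (hD : 0 < D) (hG : 0 < G)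
    (hGA : G ≤ A) (hT0 : 0 < T) (hT : T = iterations (72 ^ 2) m D A δ ε)
    (hη : η = D / (G * √T)) :
    D ^ 2 / (2 * η) + η * T * G ^ 2 / 2 + 2 * (G * D) * √(2 * T * Real.log (1 / δ)) ≤ ε * T := by
  have hx := one_le_one_add_log_natCast m
  have hy := one_le_one_add_log_one_div hδ hδ1
  have hs : 0 < √(T : ℝ) := Real.sqrt_pos.2 (Nat.cast_pos.2 hT0)
  have hdescent := descent_error_le le_rfl (Real.one_le_sqrt.2 hy) hs hD hG hG.le le_rfl
    (hη.trans (by rw [one_mul])) (L := Real.log (1 / δ))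
    (by rw [Real.sq_sqrt (by linarith)]; linarith)
  rw [Real.sq_sqrt (Nat.cast_nonneg T)] at hdescent
  refine (hdescent.trans ?_).trans (mul_sqrt_iterations_le hε hδ hδ1 hT)
  have := hG.trans_le hGA
  have := Real.one_le_sqrt.2 hx
  gcongr
  norm_num

lemma LightExecution.sum_gap_eq_add [NeZero m] {k : ℕ}
    (h : LightExecution P ℱ W f g dg Gf γ η k T w₁ ξ i S) (hu : u ∈ feasible W g) (j : Fin m)
    (ω : Ω) :
    ∑ t ∈ Finset.range T, (f (h.state t ω).w + γ * max 0 (g j (h.state t ω).w) - f u) =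
      ∑ t ∈ Finset.range T, (f (h.state t ω).w - f u + γ * ∑ l, (h.state t ω).p l *
        (max 0 (g l (h.state t ω).w) - max 0 (g l u))) +
      ∑ t ∈ Finset.range T, γ * (max 0 (g j (h.state t ω).w) -
        ∑ l, (h.state t ω).p l * max 0 (g l (h.state t ω).w)) := by
  rw [← Finset.sum_add_distrib]
  refine Finset.sum_congr rfl fun t _ => ?_
  simp only [max_eq_left (hu.2 _), sub_zero]
  ring

lemma LightExecution.measureReal_gap_gt_le [IsProbabilityMeasure P] [NeZero m]
    (h : LightExecution P ℱ W f g dg Gf γ η (minibatchSize m δ T) T w₁ ξ i S)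
    (hd : ConstraintData W g dg Lg D Gg) (hu : u ∈ feasible W g) (hγ : 0 ≤ γ) (hD : 1 ≤ D)
    (hG : 0 < Gf + γ * Gg) (hGA : Gf + γ * Gg ≤ A) (hβA : γ * (Lg * D) ≤ A) (hε : 0 < ε)
    (hδ : 0 < δ) (hδ1 : δ < 1) (hT : T = iterations (72 ^ 2) m D A δ ε)
    (hk : minibatchSize m δ T ≤ m) (hη : η = √(1 + Real.log m) * D / (A * √T)) :
    P.real {ω | ∃ j, ε * T < ∑ t ∈ Finset.range T,
      (f (h.state t ω).w + γ * max 0 (g j (h.state t ω).w) - f u)} ≤ δ := by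
  have hD0 : 0 < D := one_pos.trans_le hD
  have hA : 0 < A := hG.trans_le hGA
  have hT0 : 0 < T := hT ▸ iterations_pos (by norm_num) hD0 hA hε hδ hδ1
  have hβ : 0 ≤ γ * (Lg * D) := by positivity
  have hη0 : 0 < η := by
    have := one_le_one_add_log_natCast m
    rw [hη]
    positivity
  have hk0 : 0 < minibatchSize m δ T := minibatchSize_pos hT0 hδ hδ1
  have hLdescent := one_le_log_three_mul_div le_rfl hδ hδ1
  have hLweights := one_le_log_three_mul_div (Nat.one_le_cast.2 (NeZero.pos m)) hδ hδ1
  rw [mul_one] at hLdescent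
  have hdescent := (h.sampledDescent hd ⟨u, hu.1⟩).measureReal_regret_gt_le hd.oracle hd.convex
    hd.isClosed hγ hη0 hT0 hd.diam hD0 hG hu.1 (zero_le_one.trans hLdescent)
  have hweights := h.measureReal_weights_regret_gt_le hd hu hγ hη0 hG.le hT0 hk0 hk
    (b := 4 * A) (by positivity) (staleness_le hT0 hδ hδ1 hk hA hG.le hGA hβA hη)
    (zero_le_one.trans hLweights)
  refine le_trans ?_ ((add_le_add hdescent hweights).trans
    (failure_probability_le hT0 hδ hk0 hk (Nat.le_ceil _)))
  refine le_trans (measureReal_mono ?_ (measure_ne_top _ _)) (measureReal_union_le _ _)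
  rintro ω ⟨j, hj⟩
  by_contra hgood
  obtain ⟨hdescentω, hweightsω⟩ := not_or.1 hgood
  have herrors := light_errors_le hε hδ hδ1 hD hA hG.le hGA hβ hβA hT0 hT hη
  rw [h.sum_gap_eq_add hu] at hj
  exact hj.not_ge ((add_le_add (not_lt.1 hdescentω)
    (not_lt.1 fun hlt => hweightsω ⟨j, hlt⟩)).trans herrors)

lemma fullIter_checks_eq (sel : (Fin m → ℝ) → Fin m) (w : E d) (x : ℕ → E d) (t : ℕ) :
    (fullIter W g dg sel γ η w x t).checks = t * (m + 1) := by
  induction t with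
  | zero => simp [fullIter, pure]
  | succ t ih =>
    have hstep : (fullIter W g dg sel γ η w x (t + 1)).checks =
      (fullIter W g dg sel γ η w x t).checks +
        ((∑ _j : Fin m, 1) + (1 + 0)) := rfl
    rw [hstep, ih, Finset.sum_const, Finset.card_fin, smul_eq_mul]
    ring

namespace FullExecution

variable {sel : (Fin m → ℝ) → Fin m}

/-- The random iterate of FullTouch after `t` iterations. The execution `_h` only serves to supply
the parameters of the algorithm. -/
noncomputable def iterate (_h : FullExecution P ℱ W f g dg sel Gf γ η T w₁ ξ) (t : ℕ) (ω : Ω) :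
    E d :=
  (fullIter W g dg sel γ η (w₁ ω) (fun s => ξ s ω) t).val

variable (h : FullExecution P ℱ W f g dg sel Gf γ η T w₁ ξ)
include h

lemma iterate_succ (t : ℕ) (ω : Ω) : h.iterate (t + 1) ω =
    proj W (h.iterate t ω - η • (ξ t ω + γ •
      dg (sel fun j => g j (h.iterate t ω)) (h.iterate t ω))) := by
  have hstep : h.iterate (t + 1) ω = proj W (h.iterate t ω - η • (ξ t ω + γ •
      dg (sel fun j => if j ∈ Finset.univ then g j (h.iterate t ω) else 0) (h.iterate t ω))) := rfl
  simpa only [Finset.mem_univ, if_true] using hstep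

lemma iterate_mem (hW : IsClosed W) (t : ℕ) (ω : Ω) : h.iterate t ω ∈ W := by
  cases t with
  | zero => exact h.init_mem ω
  | succ t => exact h.iterate_succ t ω ▸ proj_mem hW ⟨_, h.init_mem ω⟩ _

lemma measurableSet_sel_eq (hd : ConstraintData W g dg Lg D Gg) (hsel : Measurable sel)
    {m₀ : MeasurableSpace Ω} {t : ℕ} (hw : Measurable[m₀] (h.iterate t)) (j : Fin m) :
    MeasurableSet[m₀] {ω | sel (fun l => g l (h.iterate t ω)) = j} :=
  hsel.comp (measurable_pi_lambda _ fun l => hd.measurable_comp hw (h.iterate_mem hd.isClosed t) l)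
    (measurableSet_singleton j)

lemma measurable_iterate (hd : ConstraintData W g dg Lg D Gg) (hne : W.Nonempty)
    (hsel : Measurable sel) {t : ℕ} (ht : t ≤ T) : Measurable[ℱ t] (h.iterate t) := by
  induction t with
  | zero => exact h.init_measurable.measurable
  | succ t ih =>
    have hw := (ih (t.le_succ.trans ht)).mono (ℱ.mono t.le_succ) le_rfl
    rw [show h.iterate (t + 1) = _ from funext (h.iterate_succ t)]
    exact hd.measurable_proj_step γ η hne hw (h.subgradients.adapted t ht).measurable
      (h.measurableSet_sel_eq hd hsel hw)

lemma sampledDescent [IsFiniteMeasure P] (hd : ConstraintData W g dg Lg D Gg) (hne : W.Nonempty)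
    (hsel : Measurable sel) :
    SampledDescent P ℱ W f dg Gf γ η T h.iterate ξ
      (fun t ω => sel fun j => g j (h.iterate t ω))
      (fun t ω j => {ω | sel (fun l => g l (h.iterate t ω)) = j}.indicator (fun _ => 1) ω) := by
  have hmeas : ∀ t < T, ∀ j, MeasurableSet[ℱ t] {ω | sel (fun l => g l (h.iterate t ω)) = j} :=
    fun t ht j => h.measurableSet_sel_eq hd hsel (h.measurable_iterate hd hne hsel ht.le) j
  exact
    { measurable := fun t ht => h.measurable_iterate hd hne hsel ht.le
      mem := h.iterate_mem hd.isClosed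
      subgradients := h.subgradients
      index_adapted := fun t ht j => ℱ.mono t.le_succ _ (hmeas t ht j)
      index_law := fun t ht j => by
        rw [condExp_of_stronglyMeasurable (ℱ.le t)
          (stronglyMeasurable_const.indicator (hmeas t ht j))
          ((integrable_const _).indicator (ℱ.le t _ (hmeas t ht j)))]
      step := fun t ω => h.iterate_succ t ω }

lemma measureReal_gap_gt_le [IsProbabilityMeasure P] (hd : ConstraintData W g dg Lg D Gg)
    (hsel : Measurable sel) (hmax : ∀ (v : Fin m → ℝ) (j : Fin m), v j ≤ v (sel v))
    (hu : u ∈ feasible W g) (hγ : 0 ≤ γ) (hD : 0 < D) (hG : 0 < Gf + γ * Gg) (hGA : Gf + γ * Gg ≤ A)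
    (hε : 0 < ε) (hδ : 0 < δ) (hδ1 : δ < 1) (hT : T = iterations (72 ^ 2) m D A δ ε)
    (hη : η = D / ((Gf + γ * Gg) * √T)) :
    P.real {ω | ∃ j, ε * T < ∑ t ∈ Finset.range T,
      (f (h.iterate t ω) + γ * max 0 (g j (h.iterate t ω)) - f u)} ≤ δ := by
  have hT0 : 0 < T := hT ▸ iterations_pos (by norm_num) hD (hG.trans_le hGA) hε hδ hδ1
  have hη0 : 0 < η := by rw [hη]; positivity
  have hdescent := (h.sampledDescent hd ⟨u, hu.1⟩ hsel).measureReal_regret_gt_le hd.oracle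
    hd.convex hd.isClosed hγ hη0 hT0 hd.diam hD hG hu.1 (L := Real.log (1 / δ))
    (Real.log_nonneg (one_le_one_div hδ hδ1.le))
  rw [Real.exp_neg, Real.exp_log (by positivity), one_div, inv_inv, ← one_div] at hdescent
  refine le_trans (measureReal_mono ?_ (measure_ne_top _ _)) hdescent
  rintro ω ⟨j, hj⟩
  refine (full_errors_le hε hδ hδ1 hD hG hGA hT0 hT hη).trans_lt (hj.trans_le ?_)
  refine Finset.sum_le_sum fun t _ => ?_
  have hle : g j (h.iterate t ω) ≤ g (sel fun l => g l (h.iterate t ω)) (h.iterate t ω) :=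
    hmax (fun l => g l (h.iterate t ω)) j
  have hsum : ∑ l, {ω | sel (fun l => g l (h.iterate t ω)) = l}.indicator (fun _ => (1 : ℝ)) ω *
      max 0 (g l (h.iterate t ω)) =
      max 0 (g (sel fun l => g l (h.iterate t ω)) (h.iterate t ω)) := by
    simp [Set.indicator_apply]
  simp only [max_eq_left (hu.2 _), sub_zero, hsum]
  rw [add_sub_right_comm]
  gcongr

end FullExecution

end Conclusion

end LightTouch

theorem mainTheorem1 :
    -- universal constants
    ∃ c > (0 : ℝ), ∃ K > (0 : ℝ),
    ∀ (d m : ℕ) [NeZero m]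
      -- the convex problem
      (W : Set (E d)) (f : E d → ℝ) (g : Fin m → E d → ℝ),
      Convex ℝ W → IsClosed W → ConvexOn ℝ W f → (∀ i, ConvexOn ℝ W (g i)) →
    ∀ (Lf Lg : ℝ≥0), LipschitzOnWith Lf f W → (∀ i, LipschitzOnWith Lg (g i) W) →
    -- subgradients of the combined constraint are bounded away from zero on its boundary
    ∀ (ρ : ℝ), 0 < ρ →
      (∀ w ∈ W, maxConstraint g w = 0 →
        ∀ v ∈ subdifferential W (maxConstraint g) w, ρ ≤ ‖v‖) →
    ∀ (γ : ℝ), (Lf : ℝ) / ρ < γ →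
    -- diameter
    ∀ (D : ℝ), 1 ≤ D → (∀ w ∈ W, ∀ w' ∈ W, ‖w - w'‖ ≤ D) →
    -- subgradient oracle for the constraints
    ∀ (Gf Gg : ℝ) (dg : Fin m → E d → E d), (∀ i, Measurable (dg i)) →
      (∀ i, ∀ w ∈ W, dg i w ∈ subdifferential W (fun x => max 0 (g i x)) w) →
      (∀ i, ∀ w ∈ W, ‖dg i w‖ ≤ Gg) →
      0 ≤ Gf → 0 ≤ Gg → 0 < Gf + γ * Gg →
    -- reference point, accuracy, confidence
    ∀ wstar ∈ feasible W g,
    ∀ (ε δ : ℝ), 0 < ε → 0 < δ → δ < 1 →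
    ∀ (A : ℝ), A = Gf + γ * Gg + γ * Lg * D →
    ∀ (T k : ℕ), T = iterations c m D A δ ε → k = minibatchSize m δ T →
    ∀ {Ω : Type*} {mΩ : MeasurableSpace Ω} (P : Measure Ω) [IsProbabilityMeasure P]
      (ℱ : Filtration ℕ mΩ),
      -- if `k ≤ m`: LightTouch
      (k ≤ m →
        ∀ (η : ℝ), η = Real.sqrt (1 + Real.log m) * D / (A * Real.sqrt T) →
        ∀ (w₁ : Ω → E d) (ξ : ℕ → Ω → E d) (i : ℕ → Ω → Fin m) (S : ℕ → Ω → Finset (Fin m)),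
          LightExecution P ℱ W f g dg Gf γ η k T w₁ ξ i S →
          ∀ (out : Ω → Counted (E d)),
            (∀ ω, out ω = lightTouch W g dg γ η k T (w₁ ω) (fun t => ξ t ω) (fun t => i t ω)
              (fun t => S t ω)) →
            1 - δ ≤ P.real {ω | Guarantee W f g γ ρ Lf ε wstar (out ω).val} ∧
            (ε ≤ D * A → ∀ ω, ((out ω).checks : ℝ) ≤ K * checksBound m D A δ ε T)) ∧
      -- if `k > m`: FullTouch
      (m < k →
        ∀ (η : ℝ), η = D / ((Gf + γ * Gg) * Real.sqrt T) →
        ∀ (sel : (Fin m → ℝ) → Fin m), Measurable sel → (∀ (v : Fin m → ℝ) (j : Fin m), v j ≤ v (sel v)) →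
        ∀ (w₁ : Ω → E d) (ξ : ℕ → Ω → E d),
          FullExecution P ℱ W f g dg sel Gf γ η T w₁ ξ →
          ∀ (out : Ω → Counted (E d)),
            (∀ ω, out ω = fullTouch W g dg sel γ η T (w₁ ω) (fun t => ξ t ω)) →
            1 - δ ≤ P.real {ω | Guarantee W f g γ ρ Lf ε wstar (out ω).val} ∧
            (ε ≤ D * A → ∀ ω, ((out ω).checks : ℝ) ≤ K * checksBound m D A δ ε T)) := by
  refine ⟨72 ^ 2, by norm_num, 2 * (72 ^ 2 + 1), by norm_num, ?_⟩
  intro d m _ W f g hW hWc hf hg Lf Lg hfL hgL ρ hρ0 hρ γ hγ D hD hdiam Gf Gg dg hdgm hdgs hdgn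
    _ _ hG wstar hstar ε δ hε hδ hδ1 A hA T k hT hk Ω mΩ P _ ℱ
  subst hk
  have hD0 : 0 < D := one_pos.trans_le hD
  have hγ0 : 0 < γ := lt_of_le_of_lt (by positivity) hγ
  have hβ : 0 ≤ γ * Lg * D := by positivity
  have hd : ConstraintData W g dg Lg D Gg := ⟨hW, hWc, hdiam, hgL, hdgm, hdgs, hdgn⟩
  have hT0 : 0 < T := hT ▸ iterations_pos (by norm_num) hD0 (by linarith) hε hδ hδ1
  have hWb : Bornology.IsBounded W :=
    Metric.isBounded_iff.2 ⟨D, fun x hx y hy => dist_eq_norm x y ▸ hdiam x hx y hy⟩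
  obtain ⟨u, hu, guarantee⟩ := exists_feasible_forall_guarantee hWc hWb hf hg hfL
    (fun j => (hgL j).continuousOn) hρ hγ0.le ((div_lt_iff₀ hρ0).1 hγ) ε hstar hT0
  refine ⟨fun hk η hη w₁ ξ i S h out hout => ?_,
    fun hk η hη sel hsel hmax w₁ ξ h out hout => ?_⟩ <;> obtain rfl := funext hout
  · refine ⟨one_sub_le_measureReal (fun ω hω => ?_) (h.measureReal_gap_gt_le hd hu hγ0.le hD hG
      (by linarith) (by linarith) hε hδ hδ1 hT hk hη), fun hεDA ω => ?_⟩
    · exact guarantee _ (fun t => h.w_mem hWc t ω) fun j => not_lt.1 fun hj => hω ⟨j, hj⟩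
    · exact (h.checks_eq ω le_rfl).symm ▸ mod_cast
        light_checks_le (by norm_num) hD0 (by linarith) hε hδ hδ1 hεDA hT
  · refine ⟨one_sub_le_measureReal (fun ω hω => ?_) (h.measureReal_gap_gt_le hd hsel hmax hu
      hγ0.le hD0 hG (by linarith) hε hδ hδ1 hT hη), fun hεDA ω => ?_⟩
    · exact guarantee _ (fun t => h.iterate_mem hWc t ω) fun j => not_lt.1 fun hj => hω ⟨j, hj⟩
    · exact (congrArg Nat.cast (fullIter_checks_eq sel _ _ T)).trans_le (mod_cast
        full_checks_le (by norm_num) hD0 (by linarith) hε hδ hδ1 hεDA hT hk)
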